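/- Let $\mathbb H$ be the upper half-plane, $\overline{\mathbb R}=\mathbb R\cup\{\infty\}$ and $\overline{\mathbb C}=\mathbb C\cup\{\infty\}$, and let $\chi$ be the chordal metric on $\overline{\mathbb C}$, so that $\chi(z,w)=\dfrac{2|z-w|}{\sqrt{1+|z|^2}\sqrt{1+|w|^2}}$ and $\chi(z,\infty)=\dfrac{2}{\sqrt{1+|z|^2}}$ for $z,w\in\mathbb C$. Let $\mathcal M$ be the group of real Möbius transformations $z\mapsto (az+b)/(cz+d)$ of $\overline{\mathbb C}$, with $a,b,c,d\in\mathbb R$ and $ad-bc>0$, equipped with the metric $\chi_0(f,g)=\sup_{z\in\overline{\mathbb C}}\chi(f(z),g(z))$, and let $I$ be its identity element. A composition sequence generated by a set $\mathcal F\subset\mathcal M$ is a sequence $F_n=f_1 f_2\cdots f_n$ of compositions with $f_i\in\mathcal F$ for each $i$ (and $F_0=I$). A sequence $(F_n)$ in $\mathcal M$ is an escaping sequence if, for some $w\in\mathbb H$, the sequence $(F_n(w))$ has no accumulation point in $\mathbb H$. It converges ideally if it is an escaping sequence and there is a point $p\in\overline{\mathbb R}$ such that $\chi(F_n(w),p)\to0$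 as $n\to\infty$ for every $w\in\mathbb H$. A subset $S$ of $\mathcal M$ that is closed under composition is called semidiscrete if $I$ is not an accumulation point of $S$ in $\mathcal M$, and inverse free if $g^{-1}\notin S$ for every $g\in S$. Theorem. Let $\mathcal F$ be a finite subset of $\mathcal M$, and let $S$ be the semigroup generated by $\mathcal F$, that is, the set of all compositions of finitely many (at least one) elements of $\mathcal F$. The following three statements are equivalent: (i) every composition sequence generated by $\mathcal F$ is an escaping sequence; (ii) every composition sequence generated by $\mathcal F$ converges ideally; (iii) $S$ is semidiscrete and inverse free. -/

import Mathlib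

open Filter Topology OnePoint
open scoped UpperHalfPlane MatrixGroups

noncomputable section

namespace RealMobius

/-! ### The chordal metric on the extended complex plane -/

/-- The chordal metric on the extended complex plane `ℂ ∪ {∞}`. -/
def chordal : OnePoint ℂ → OnePoint ℂ → ℝ
  | OnePoint.some z, OnePoint.some w =>
      2 * ‖z - w‖ / (Real.sqrt (1 + ‖z‖ ^ 2) * Real.sqrt (1 + ‖w‖ ^ 2))
  | OnePoint.some z, ∞ => 2 / Real.sqrt (1 + ‖z‖ ^ 2)
  | ∞, OnePoint.some w => 2 / Real.sqrt (1 + ‖w‖ ^ 2)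
  | ∞, ∞ => 0

/-- Stereographic projection onto the unit sphere of `ℝ³` (used only to verify the metric axioms
of `chordal`). -/
def stereo : OnePoint ℂ → EuclideanSpace ℝ (Fin 3)
  | OnePoint.some z =>
      !₂[2 * z.re / (1 + ‖z‖ ^ 2), 2 * z.im / (1 + ‖z‖ ^ 2), (‖z‖ ^ 2 - 1) / (1 + ‖z‖ ^ 2)]
  | ∞ => !₂[0, 0, 1]

theorem chordal_eq_dist_stereo (z w : OnePoint ℂ) : chordal z w = dist (stereo z) (stereo w) := by
  have key : ∀ z : ℂ, 0 < 1 + (z.re * z.re + z.im * z.im) := fun z => by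
    nlinarith [mul_self_nonneg z.re, mul_self_nonneg z.im]
  rw [EuclideanSpace.dist_eq, eq_comm, Real.sqrt_eq_iff_mul_self_eq]
  · induction z using OnePoint.rec <;> induction w using OnePoint.rec
    · simp [chordal, stereo]
    · rename_i w
      have hw := key w
      simp only [chordal, stereo, Fin.sum_univ_three, Real.dist_eq, sq_abs, div_mul_div_comm]
      rw [Real.mul_self_sqrt (by positivity)]
      simp [Complex.sq_norm, Complex.normSq_apply]
      field_simp
      ring
    · rename_i z
      have hz := key z
      simp only [chordal, stereo, Fin.sum_univ_three, Real.dist_eq, sq_abs, div_mul_div_comm]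
      rw [Real.mul_self_sqrt (by positivity)]
      simp [Complex.sq_norm, Complex.normSq_apply]
      field_simp
      ring
    · rename_i z w
      have hz := key z
      have hw := key w
      simp only [chordal, stereo, Fin.sum_univ_three, Real.dist_eq, sq_abs, div_mul_div_comm]
      rw [mul_mul_mul_comm (Real.sqrt _), Real.mul_self_sqrt (by positivity),
        Real.mul_self_sqrt (by positivity), mul_mul_mul_comm, ← sq ‖z - w‖]
      simp [Complex.sq_norm, Complex.normSq_apply]
      field_simp
      ring
  · positivity
  · induction z using OnePoint.rec <;> induction w using OnePoint.rec <;>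
      simp only [chordal] <;> positivity

theorem norm_stereo (z : OnePoint ℂ) : ‖stereo z‖ = 1 := by
  have key : ∀ z : ℂ, 0 < 1 + (z.re * z.re + z.im * z.im) := fun z => by
    nlinarith [mul_self_nonneg z.re, mul_self_nonneg z.im]
  rw [EuclideanSpace.norm_eq, Real.sqrt_eq_one]
  induction z using OnePoint.rec
  · simp [stereo, Fin.sum_univ_three]
  · rename_i z
    have hz := key z
    simp only [stereo, Fin.sum_univ_three, Real.norm_eq_abs, sq_abs]
    simp [Complex.sq_norm, Complex.normSq_apply]
    field_simp
    ring

theorem chordal_le_two (z w : OnePoint ℂ) : chordal z w ≤ 2 := by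
  rw [chordal_eq_dist_stereo, dist_eq_norm]
  refine (norm_sub_le _ _).trans ?_
  rw [norm_stereo, norm_stereo]
  norm_num

theorem eq_of_chordal_eq_zero {z w : OnePoint ℂ} (h : chordal z w = 0) : z = w := by
  have key : ∀ z : ℂ, Real.sqrt (1 + ‖z‖ ^ 2) ≠ 0 := fun z => by positivity
  induction z using OnePoint.rec <;> induction w using OnePoint.rec
  · rfl
  · simp [chordal, key] at h
  · simp [chordal, key] at h
  · simp [chordal, key, sub_eq_zero] at h
    rw [h]

/-! ### The group of real Möbius transformations -/

/-- The group of real Möbius transformations `z ↦ (a z + b) / (c z + d)`, with `a, b, c, d` real and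
`a d - b c > 0`, as a group of permutations of the extended complex plane: the image of
`GL(2, ℝ)⁺` in the permutation group under the standard action of `GL(2, ℂ)` on `ℂ ∪ {∞}`. -/
def mobiusSubgroup : Subgroup (Equiv.Perm (OnePoint ℂ)) :=
  (((MulAction.toPermHom (GL (Fin 2) ℂ) (OnePoint ℂ)).comp
    (Matrix.GeneralLinearGroup.map (algebraMap ℝ ℂ))).comp
      (Matrix.GLPos (Fin 2) ℝ).subtype).range

/-- The type of real Möbius transformations. -/
def Mob : Type := mobiusSubgroup

/-- The group law is composition of maps: `(f * g) z = f (g z)`. -/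
instance : Group Mob := inferInstanceAs (Group mobiusSubgroup)

instance : CoeFun Mob (fun _ => OnePoint ℂ → OnePoint ℂ) :=
  ⟨fun f => (f.1 : OnePoint ℂ → OnePoint ℂ)⟩

theorem Mob.bddAbove_chordal (f g : Mob) :
    BddAbove (Set.range fun z : OnePoint ℂ => chordal (f z) (g z)) :=
  ⟨2, by rintro _ ⟨z, rfl⟩; exact chordal_le_two _ _⟩

/-- The uniform metric `dist f g = sup_z χ(f z, g z)` on real Möbius transformations, where `χ` is
the chordal metric. -/
instance : MetricSpace Mob where
  dist f g := ⨆ z : OnePoint ℂ, chordal (f z) (g z)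
  dist_self f := by simp [chordal_eq_dist_stereo]
  dist_comm f g := by simp only [chordal_eq_dist_stereo, dist_comm]
  dist_triangle f g h := by
    refine ciSup_le fun z => ?_
    refine le_trans ?_ (add_le_add (le_ciSup (Mob.bddAbove_chordal f g) z)
      (le_ciSup (Mob.bddAbove_chordal g h) z))
    simp only [chordal_eq_dist_stereo]
    exact dist_triangle _ _ _
  eq_of_dist_eq_zero {f g} h := by
    refine Subtype.ext (Equiv.ext fun z => eq_of_chordal_eq_zero (le_antisymm ?_ ?_))
    · exact (le_ciSup (Mob.bddAbove_chordal f g) z).trans h.le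
    · rw [chordal_eq_dist_stereo]
      exact dist_nonneg

/-! ### Sequences of Möbius transformations -/

/-- A point of the upper half-plane, as a point of the extended complex plane. -/
def ofH (w : ℍ) : OnePoint ℂ := ((w : ℂ) : OnePoint ℂ)

/-- The extended real line `ℝ ∪ {∞}` inside the extended complex plane. -/
def extendedReals : Set (OnePoint ℂ) :=
  insert ∞ (Set.range fun x : ℝ => ((x : ℂ) : OnePoint ℂ))

/-- `F` is a composition sequence generated by `𝓕`: `F₀ = I` and `Fₙ = f₁ f₂ ⋯ fₙ` with all `fᵢ`
in `𝓕` (here `fᵢ` is `f (i - 1)`). -/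
def IsCompositionSeq (𝓕 : Set Mob) (F : ℕ → Mob) : Prop :=
  ∃ f : ℕ → Mob, (∀ i, f i ∈ 𝓕) ∧ F 0 = 1 ∧ ∀ n, F (n + 1) = F n * f n

/-- `F` is an escaping sequence: for some point `w` of the upper half-plane, the sequence `Fₙ(w)`
has no accumulation point in the upper half-plane. -/
def IsEscaping (F : ℕ → Mob) : Prop :=
  ∃ w : ℍ, ∀ z : ℍ, ¬ MapClusterPt (ofH z) atTop (fun n => F n (ofH w))

/-- `F` is an escaping sequence such that, for some point `p` of the extended real line, `Fₙ(w)`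
converges to `p` in the chordal metric, for every point `w` of the upper half-plane. -/
def ConvergesIdeally (F : ℕ → Mob) : Prop :=
  IsEscaping F ∧ ∃ p ∈ extendedReals, ∀ w : ℍ,
    Tendsto (fun n => chordal (F n (ofH w)) p) atTop (𝓝 0)

/-! ### Semigroups of Möbius transformations -/

/-- The identity is not an accumulation point of `S` in the group of real Möbius transformations. -/
def IsSemidiscrete (S : Subsemigroup Mob) : Prop :=
  ¬ AccPt (1 : Mob) (𝓟 (S : Set Mob))

/-- No element of `S` has its inverse in `S`. -/
def IsInverseFree (S : Subsemigroup Mob) : Prop :=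
  ∀ g ∈ S, g⁻¹ ∉ S

end RealMobius

end

namespace RealMobius

/-! Everything is lifted to a finite set of matrices in `SL(2, ℝ)`, where escape means that the
orbit of `I` leaves every hyperbolic ball. Statement (iii) says exactly that the identity is not in
the closure of the semigroup. If it is in the closure, elements moving `I` by less than `2⁻ᵏ`
multiply to a bounded orbit; if some sequence does not escape, its partial products accumulate and
the quotients `Fₘ⁻¹ Fₙ` approach the identity. This gives (i) ⇔ (iii).

For (i) ⇒ (ii), let matrices act on row vectors from the right. By `Escapes.exists_row`, some row
`r` is not contracted to zero by the semigroup: otherwise one could keep a product bounded by always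
contracting the longer of its two rows. After a rotation `B` taking the boundary point annihilated
by `r` to infinity, the points `zₙ = B Fₙ I` have bounded height. They also escape, so if their real
parts have a limit in `[-∞, ∞]`, the sequence converges ideally.

If instead the real parts oscillate across an interval, bounded steps force `zₙ` into every horodisc
based at each point of that interval, so a whole arc of rows is contracted along the sequence. Then
all non-contracted rows are parallel (`det_eq_zero_of_contracted_arc`), so `r` is a common
eigenvector and the conjugated semigroup consists of affine maps `z ↦ y z + x`. Bounded height gives
`y ≤ 1`, escape forbids opposite translations, and by finiteness `xₙ` or `-xₙ` becomes monotone
after a correction by a multiple of the convergent `yₙ`, which contradicts oscillation. -/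

/-! ### Homogeneous coordinates and lifting to `SL(2, ℝ)` -/

/-- The point of `ℂ ∪ {∞}` with homogeneous coordinates `[u : v]`. -/
noncomputable def hpt (u v : ℂ) : OnePoint ℂ := if v = 0 then ∞ else ((u / v : ℂ) : OnePoint ℂ)

/-- In homogeneous coordinates the chordal distance is a normalised determinant, so infinity needs
no separate treatment afterwards. -/
theorem chordal_hpt {u v s t : ℂ} (h : u ≠ 0 ∨ v ≠ 0) (h' : s ≠ 0 ∨ t ≠ 0) :
    chordal (hpt u v) (hpt s t) =
      2 * ‖u * t - v * s‖ / (√(‖u‖ ^ 2 + ‖v‖ ^ 2) * √(‖s‖ ^ 2 + ‖t‖ ^ 2)) := by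
  have key : ∀ {a b : ℂ}, b ≠ 0 → √(1 + ‖a / b‖ ^ 2) = √(‖a‖ ^ 2 + ‖b‖ ^ 2) / ‖b‖ := by
    intro a b hb
    have hb' : 0 < ‖b‖ := norm_pos_iff.mpr hb
    rw [eq_div_iff hb'.ne']
    conv_lhs => rw [← Real.sqrt_sq hb'.le]
    rw [← Real.sqrt_mul (by positivity), norm_div]
    congr 1
    field_simp
    ring
  have pos : ∀ {a b : ℂ}, b ≠ 0 → 0 < √(‖a‖ ^ 2 + ‖b‖ ^ 2) := by
    intro a b hb
    have hb' : 0 < ‖b‖ := norm_pos_iff.mpr hb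
    positivity
  unfold hpt
  by_cases hv : v = 0 <;> by_cases ht : t = 0
  · simp [hv, ht, chordal]
  · have hu : ‖u‖ ≠ 0 := by simpa [hv] using h
    have ht' : ‖t‖ ≠ 0 := by simpa using ht
    have := (pos (a := s) ht).ne'
    simp only [hv, ht, if_true, if_false, chordal, key ht]
    simp [Real.sqrt_sq (norm_nonneg u)]
    field_simp
  · have hs : ‖s‖ ≠ 0 := by simpa [ht] using h'
    have hv' : ‖v‖ ≠ 0 := by simpa using hv
    have := (pos (a := u) hv).ne'
    simp only [hv, ht, if_true, if_false, chordal, key hv]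
    simp [Real.sqrt_sq (norm_nonneg s)]
    field_simp
  · have hv' : ‖v‖ ≠ 0 := by simpa using hv
    have ht' : ‖t‖ ≠ 0 := by simpa using ht
    have h1 := (pos (a := u) hv).ne'
    have h2 := (pos (a := s) ht).ne'
    simp only [hv, ht, if_false, chordal, key hv, key ht]
    have : u / v - s / t = (u * t - v * s) / (v * t) := by field_simp
    rw [this, norm_div, norm_mul]
    field_simp

theorem exists_hpt (z : OnePoint ℂ) : ∃ u v : ℂ, (u ≠ 0 ∨ v ≠ 0) ∧ z = hpt u v := by
  induction z using OnePoint.rec with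
  | infty => exact ⟨1, 0, by simp, by simp [hpt]⟩
  | coe z => exact ⟨z, 1, by simp, by simp [hpt]⟩

/-- The real Möbius transformation of a matrix of determinant one. -/
noncomputable def toMob : SL(2, ℝ) →* Mob :=
  (((MulAction.toPermHom (GL (Fin 2) ℂ) (OnePoint ℂ)).comp
    ((Matrix.GeneralLinearGroup.map (algebraMap ℝ ℂ)).comp
      Matrix.SpecialLinearGroup.toGL)).codRestrict mobiusSubgroup
        fun A => ⟨⟨(A : GL (Fin 2) ℝ), by simp [Matrix.GLPos]⟩, rfl⟩ : SL(2, ℝ) →* mobiusSubgroup)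

theorem toMob_apply (A : SL(2, ℝ)) (z : OnePoint ℂ) : toMob A z =
    Matrix.GeneralLinearGroup.map (algebraMap ℝ ℂ) (A : GL (Fin 2) ℝ) • z := rfl

theorem toMob_hpt (A : SL(2, ℝ)) {u v : ℂ} (h : u ≠ 0 ∨ v ≠ 0) :
    toMob A (hpt u v) = hpt (A 0 0 * u + A 0 1 * v) (A 1 0 * u + A 1 1 * v) := by
  rw [toMob_apply]
  unfold hpt
  by_cases hv : v = 0
  · have hu : u ≠ 0 := by simpa [hv] using h
    simp only [hv, if_true, OnePoint.smul_infty_eq_ite]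
    by_cases hc : A 1 0 = 0
    · simp [hc]
    · simp [hc, hu]
      rw [mul_div_mul_right _ _ hu]
  · simp only [hv, if_false, OnePoint.smul_some_eq_ite]
    have e : (A 1 0 : ℂ) * (u / v) + A 1 1 = (A 1 0 * u + A 1 1 * v) / v := by field_simp
    have e' : (A 0 0 : ℂ) * (u / v) + A 0 1 = (A 0 0 * u + A 0 1 * v) / v := by field_simp
    by_cases hc : (A 1 0 : ℂ) * u + A 1 1 * v = 0
    · simp [e, hc]
    · simp [e, e', hc, hv]
      rw [div_div_div_cancel_right₀ hv]

theorem toMob_ofH (A : SL(2, ℝ)) (w : ℍ) : toMob A (ofH w) = ofH (A • w) := by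
  have h : ofH w = hpt w 1 := by simp [ofH, hpt]
  have hd : (A 1 0 : ℂ) * w + A 1 1 ≠ 0 := UpperHalfPlane.denom_ne_zero A w
  rw [h, toMob_hpt A (by simp)]
  simp only [hpt, mul_one, hd, if_false, ofH, UpperHalfPlane.coe_specialLinearGroup_apply]
  simp

/-- Dividing a matrix by the square root of its positive determinant does not change its Möbius map.
-/
theorem toMob_surjective : Function.Surjective toMob := by
  rintro ⟨g, ⟨⟨A, hA⟩, rfl⟩⟩
  have hdet : 0 < (A : Matrix (Fin 2) (Fin 2) ℝ).det := by simpa [Matrix.GLPos] using hA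
  set D := (A : Matrix (Fin 2) (Fin 2) ℝ).det with hD
  have hs : √D ≠ 0 := (Real.sqrt_pos.mpr hdet).ne'
  have h1 : ((√D)⁻¹ • (A : Matrix (Fin 2) (Fin 2) ℝ)).det = 1 := by
    rw [Matrix.det_smul, ← hD]
    simp [Real.sq_sqrt hdet.le, hdet.ne']
  obtain ⟨B, hB⟩ : ∃ B : SL(2, ℝ), (B : Matrix (Fin 2) (Fin 2) ℝ) =
      (√D)⁻¹ • (A : Matrix (Fin 2) (Fin 2) ℝ) := ⟨⟨_, h1⟩, rfl⟩
  refine ⟨B, ?_⟩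
  · apply Subtype.ext
    apply Equiv.ext
    intro z
    change toMob B z = Matrix.GeneralLinearGroup.map (algebraMap ℝ ℂ) A • z
    have hs' : ((√D : ℝ) : ℂ) ≠ 0 := by exact_mod_cast hs
    rw [toMob_apply]
    induction z using OnePoint.rec with
    | infty =>
      simp only [OnePoint.smul_infty_eq_ite]
      simp [hB, hs', mul_div_mul_left]
    | coe z =>
      simp only [OnePoint.smul_some_eq_ite]
      simp [hB, hs', mul_div_mul_left, mul_assoc, ← mul_add]

/-! ### Comparison of the uniform, matrix and hyperbolic topologies -/

theorem norm_add_sq_le (a b : ℝ) (x y : ℂ) :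
    ‖(a : ℂ) * x + b * y‖ ^ 2 ≤ (a ^ 2 + b ^ 2) * (‖x‖ ^ 2 + ‖y‖ ^ 2) := by
  have h : ‖(a : ℂ) * x + b * y‖ ≤ |a| * ‖x‖ + |b| * ‖y‖ := by
    refine (norm_add_le _ _).trans ?_
    simp
  calc ‖(a : ℂ) * x + b * y‖ ^ 2 ≤ (|a| * ‖x‖ + |b| * ‖y‖) ^ 2 := by gcongr
    _ ≤ (|a| ^ 2 + |b| ^ 2) * (‖x‖ ^ 2 + ‖y‖ ^ 2) := by
      nlinarith [sq_nonneg (|a| * ‖y‖ - |b| * ‖x‖)]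
    _ = _ := by simp only [sq_abs]

theorem SL2_det (A : SL(2, ℝ)) : A 0 0 * A 1 1 - A 0 1 * A 1 0 = 1 := by
  rw [← Matrix.det_fin_two, A.det_coe]

theorem SL2_det_complex (A : SL(2, ℝ)) : (A 0 0 : ℂ) * A 1 1 - A 0 1 * A 1 0 = 1 := by
  exact_mod_cast SL2_det A

/-- The explicit bound tends to zero at the identity matrix. The numerator of the chordal distance
is a quadratic form whose coefficients vanish there, and the inverse matrix bounds the image vector
from below. -/
theorem dist_toMob_one_le (A : SL(2, ℝ)) : dist (toMob A) 1 ≤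
    2 * (|A 0 0 - A 1 1| + |A 0 1| + |A 1 0|) *
      √(A 0 0 ^ 2 + A 0 1 ^ 2 + A 1 0 ^ 2 + A 1 1 ^ 2) := by
  refine ciSup_le fun z => ?_
  change chordal (toMob A z) z ≤ _
  obtain ⟨u, v, h, rfl⟩ := exists_hpt z
  have hdet := SL2_det_complex A
  have eu : u = ((A 1 1 : ℝ) : ℂ) * (A 0 0 * u + A 0 1 * v) +
      ((-A 0 1 : ℝ) : ℂ) * (A 1 0 * u + A 1 1 * v) := by
    push_cast
    linear_combination -u * hdet
  have ev : v = ((-A 1 0 : ℝ) : ℂ) * (A 0 0 * u + A 0 1 * v) +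
      ((A 0 0 : ℝ) : ℂ) * (A 1 0 * u + A 1 1 * v) := by
    push_cast
    linear_combination -v * hdet
  have h' : (A 0 0 * u + A 0 1 * v : ℂ) ≠ 0 ∨ (A 1 0 * u + A 1 1 * v : ℂ) ≠ 0 := by
    by_contra hc
    push Not at hc
    rw [hc.1, hc.2] at eu ev
    simp at eu ev
    simp [eu, ev] at h
  rw [toMob_hpt A h, chordal_hpt h' h]
  have hu := norm_add_sq_le (A 1 1) (-A 0 1) (A 0 0 * u + A 0 1 * v) (A 1 0 * u + A 1 1 * v)
  have hv := norm_add_sq_le (-A 1 0) (A 0 0) (A 0 0 * u + A 0 1 * v) (A 1 0 * u + A 1 1 * v)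
  rw [← eu] at hu
  rw [← ev] at hv
  set P := ‖(A 0 0 * u + A 0 1 * v : ℂ)‖ ^ 2 + ‖(A 1 0 * u + A 1 1 * v : ℂ)‖ ^ 2 with hP
  set Q := ‖u‖ ^ 2 + ‖v‖ ^ 2 with hQ
  have Ppos : 0 < P := by
    rcases h' with h' | h' <;> have := norm_pos_iff.mpr h' <;> positivity
  have Qpos : 0 < Q := by
    rcases h with h | h <;> have := norm_pos_iff.mpr h <;> positivity
  set E := A 0 0 ^ 2 + A 0 1 ^ 2 + A 1 0 ^ 2 + A 1 1 ^ 2 with hE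
  have hQP : Q ≤ E * P := by nlinarith
  have hsq : √Q ≤ √E * √P := by
    rw [← Real.sqrt_mul (by positivity)]
    exact Real.sqrt_le_sqrt hQP
  have num : ‖(A 0 0 * u + A 0 1 * v) * v - (A 1 0 * u + A 1 1 * v) * u‖ ≤
      (|A 0 0 - A 1 1| + |A 0 1| + |A 1 0|) * Q := by
    have e : (A 0 0 * u + A 0 1 * v) * v - (A 1 0 * u + A 1 1 * v) * u =
        ((A 0 0 - A 1 1 : ℝ) : ℂ) * (u * v) + (A 0 1 : ℂ) * v ^ 2 + ((-A 1 0 : ℝ) : ℂ) * u ^ 2 := by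
      push_cast
      ring
    rw [e]
    refine (norm_add₃_le).trans ?_
    simp only [norm_mul, norm_pow, Complex.norm_real, Real.norm_eq_abs, abs_neg]
    have h1 : ‖u‖ * ‖v‖ ≤ Q := by nlinarith [sq_nonneg (‖u‖ - ‖v‖), norm_nonneg u, norm_nonneg v]
    have h2 : ‖v‖ ^ 2 ≤ Q := by nlinarith [sq_nonneg ‖u‖]
    have h3 : ‖u‖ ^ 2 ≤ Q := by nlinarith [sq_nonneg ‖v‖]
    rw [add_mul, add_mul]
    gcongr
  have hPs : 0 < √P := Real.sqrt_pos.mpr Ppos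
  have hQs : 0 < √Q := Real.sqrt_pos.mpr Qpos
  rw [div_le_iff₀ (by positivity)]
  set N := |A 0 0 - A 1 1| + |A 0 1| + |A 1 0|
  have hN : 0 ≤ N := by positivity
  calc _ ≤ 2 * (N * Q) := by gcongr
    _ = 2 * N * (√Q * √Q) := by rw [Real.mul_self_sqrt Qpos.le]; ring
    _ ≤ 2 * N * ((√E * √P) * √Q) := by gcongr
    _ = _ := by ring

theorem tendsto_dist_toMob_one : Tendsto (fun A => dist (toMob A) 1) (𝓝 1) (𝓝 0) := by
  have hc : ∀ i j, Continuous fun A : SL(2, ℝ) => A i j := fun i j => by fun_prop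
  have h00 := hc 0 0
  have h01 := hc 0 1
  have h10 := hc 1 0
  have h11 := hc 1 1
  have : Continuous fun A : SL(2, ℝ) => 2 * (|A 0 0 - A 1 1| + |A 0 1| + |A 1 0|) *
      √(A 0 0 ^ 2 + A 0 1 ^ 2 + A 1 0 ^ 2 + A 1 1 ^ 2) := by fun_prop
  refine squeeze_zero (fun _ => dist_nonneg) dist_toMob_one_le ?_
  simpa using this.tendsto 1

theorem dist_I_lt_of_chordal_lt {ε : ℝ} (hε : 0 < ε) :
    ∃ δ > 0, ∀ w : ℍ, chordal (ofH w) (ofH UpperHalfPlane.I) < δ →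
      dist w UpperHalfPlane.I < ε := by
  have h := UpperHalfPlane.isOpenEmbedding_coe.isInducing.nhds_eq_comap UpperHalfPlane.I
  have hb := Metric.ball_mem_nhds UpperHalfPlane.I hε
  rw [h, Metric.nhds_basis_ball.comap _ |>.mem_iff] at hb
  obtain ⟨η, hη, hsub⟩ := hb
  -- With `d = ‖w - I‖`, the hypothesis gives `d < δ (2 + d)`; `δ ≤ 1/2` absorbs the term `δ d`,
  -- leaving `d < 4 δ ≤ η`.
  refine ⟨min (1 / 2) (η / 4), by positivity, fun w hw => ?_⟩
  refine hsub ?_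
  set δ := min (1 / 2) (η / 4)
  have h1 : δ ≤ 1 / 2 := min_le_left _ _
  have h2 : δ ≤ η / 4 := min_le_right _ _
  simp only [ofH, chordal] at hw
  have hpos : 0 < √(1 + ‖(w : ℂ)‖ ^ 2) * √(1 + ‖(UpperHalfPlane.I : ℂ)‖ ^ 2) := by positivity
  rw [div_lt_iff₀ hpos] at hw
  have hs : √(1 + ‖(w : ℂ)‖ ^ 2) ≤ 1 + ‖(w : ℂ)‖ := by
    apply Real.sqrt_le_iff.mpr
    constructor <;> nlinarith [norm_nonneg (w : ℂ)]
  have hI : √(1 + ‖(UpperHalfPlane.I : ℂ)‖ ^ 2) ≤ 2 := by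
    apply Real.sqrt_le_iff.mpr
    constructor <;> norm_num [UpperHalfPlane.coe_I]
  have ht : ‖(w : ℂ)‖ ≤ ‖(w : ℂ) - UpperHalfPlane.I‖ + 1 := by
    have := norm_add_le ((w : ℂ) - UpperHalfPlane.I) UpperHalfPlane.I
    simpa using this
  have hδ : 0 < δ := by positivity
  have : δ * (√(1 + ‖(w : ℂ)‖ ^ 2) * √(1 + ‖(UpperHalfPlane.I : ℂ)‖ ^ 2)) ≤
      δ * ((2 + ‖(w : ℂ) - UpperHalfPlane.I‖) * 2) := by
    gcongr
    linarith
  simp only [Set.mem_preimage, Metric.mem_ball, dist_eq_norm]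
  nlinarith [norm_nonneg ((w : ℂ) - UpperHalfPlane.I)]

theorem isOpenEmbedding_ofH : IsOpenEmbedding ofH :=
  OnePoint.isOpenEmbedding_coe.comp UpperHalfPlane.isOpenEmbedding_coe

/-- The action is isometric, so the base point is irrelevant up to a bounded error, and closed
hyperbolic balls are compact. -/
theorem isEscaping_toMob_iff (A : ℕ → SL(2, ℝ)) : IsEscaping (fun n => toMob (A n)) ↔
    Tendsto (fun n => dist (A n • UpperHalfPlane.I) UpperHalfPlane.I) atTop atTop := by
  simp only [IsEscaping, toMob_ofH]
  constructor
  · rintro ⟨w, hw⟩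
    by_contra hT
    rw [tendsto_atTop] at hT
    push Not at hT
    obtain ⟨R, hR⟩ := hT
    have hfr : ∃ᶠ n in atTop, A n • w ∈
        Metric.closedBall UpperHalfPlane.I (R + dist w UpperHalfPlane.I) := by
      refine hR.mono fun n hn => ?_
      have h1 := dist_triangle (A n • w) (A n • UpperHalfPlane.I) UpperHalfPlane.I
      rw [dist_smul] at h1
      simp only [Metric.mem_closedBall]
      linarith
    obtain ⟨z, -, hz⟩ := (isCompact_closedBall _ _).exists_mapClusterPt_of_frequently hfr
    exact hw z (MapClusterPt.tendsto_comp (f := ofH) (isOpenEmbedding_ofH.continuous.tendsto z) hz)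
  · intro h
    refine ⟨UpperHalfPlane.I, fun z hz => ?_⟩
    have hz' : MapClusterPt z atTop fun n => A n • UpperHalfPlane.I := by
      refine isOpenEmbedding_ofH.isInducing.mapClusterPt_iff.mp ?_
      exact hz
    have hf := hz'.frequently (Metric.ball_mem_nhds z one_pos)
    obtain ⟨n, hn, hn'⟩ :=
      (hf.and_eventually (h.eventually_gt_atTop (1 + dist z UpperHalfPlane.I))).exists
    have := dist_triangle (A n • UpperHalfPlane.I) z UpperHalfPlane.I
    have hn : dist (A n • UpperHalfPlane.I) z < 1 := hn
    linarith

/-! ### Ideal convergence from row vectors -/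

open Matrix in
/-- If `A n` contracts some fixed row vector much more than another one, then `A n` converges
pointwise on the upper half-plane to a point of the extended real line. -/
theorem exists_tendsto_chordal {A : ℕ → SL(2, ℝ)} {ρ σ : Fin 2 → ℝ} (hρ : ρ ≠ 0) (hσ : σ ≠ 0)
    (h : Tendsto (fun n => ‖ρ ᵥ* (A n).1‖ / ‖σ ᵥ* (A n).1‖) atTop (𝓝 0)) :
    ∃ p ∈ extendedReals, ∀ w : ℍ,
      Tendsto (fun n => chordal (toMob (A n) (ofH w)) p) atTop (𝓝 0) := by
  have hρ' : ((-ρ 1 : ℝ) : ℂ) ≠ 0 ∨ ((ρ 0 : ℝ) : ℂ) ≠ 0 := by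
    by_contra hc
    push Not at hc
    apply hρ
    ext i
    fin_cases i <;> simp_all
  -- The limit is the boundary point annihilated by `ρ`. Pairing `ρ` with a vector representing `Aₙ
  -- w` is the same as pairing `ρ Aₙ` with `(w, 1)`, while `σ Aₙ` bounds the length of that vector
  -- from below.
  refine ⟨hpt ((-ρ 1 : ℝ) : ℂ) ((ρ 0 : ℝ) : ℂ), ?_, fun w => ?_⟩
  · unfold hpt extendedReals
    split_ifs
    · simp
    · refine Or.inr ⟨-ρ 1 / ρ 0, by simp⟩
  have hw : ofH w = hpt w 1 := by simp [ofH, hpt]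
  have him := w.im_pos
  set K := 1 / w.im + 1 + ‖(w : ℂ)‖ / w.im with hK
  set c := √(‖((-ρ 1 : ℝ) : ℂ)‖ ^ 2 + ‖((ρ 0 : ℝ) : ℂ)‖ ^ 2) with hc
  have cpos : 0 < c := by
    apply Real.sqrt_pos.mpr
    rcases hρ' with h' | h' <;> have := norm_pos_iff.mpr h' <;> positivity
  have hσpos : 0 < ‖σ‖ := norm_pos_iff.mpr hσ
  have key : ∀ n, chordal (toMob (A n) (ofH w)) (hpt ((-ρ 1 : ℝ) : ℂ) ((ρ 0 : ℝ) : ℂ)) ≤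
      (2 * (‖(w : ℂ)‖ + 1) * (2 * K * ‖σ‖) / c) * (‖ρ ᵥ* (A n).1‖ / ‖σ ᵥ* (A n).1‖) := by
    intro n
    set B := A n
    have hd : (B 1 0 : ℂ) * w + B 1 1 * 1 ≠ 0 := by
      rw [mul_one]
      exact UpperHalfPlane.denom_ne_zero B w
    rw [hw, toMob_hpt B (by simp), chordal_hpt (Or.inr hd) hρ', ← hc]
    set u := (B 0 0 : ℂ) * w + B 0 1 * 1
    set v := (B 1 0 : ℂ) * w + B 1 1 * 1
    set P := √(‖u‖ ^ 2 + ‖v‖ ^ 2)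
    have hu : ‖u‖ ≤ P := Real.le_sqrt_of_sq_le (by nlinarith [sq_nonneg ‖v‖])
    have hv : ‖v‖ ≤ P := Real.le_sqrt_of_sq_le (by nlinarith [sq_nonneg ‖u‖])
    have hP : 0 < P := lt_of_lt_of_le (norm_pos_iff.mpr hd) hv
    have comb : ∀ τ : Fin 2 → ℝ, (τ 0 : ℂ) * u + τ 1 * v =
        ((τ ᵥ* B.1) 0 : ℝ) * (w : ℂ) + ((τ ᵥ* B.1) 1 : ℝ) := by
      intro τ
      simp only [u, v, vecMul, dotProduct, Fin.sum_univ_two]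
      push_cast
      ring
    have num : ‖u * ((ρ 0 : ℝ) : ℂ) - v * ((-ρ 1 : ℝ) : ℂ)‖ ≤
        ‖ρ ᵥ* B.1‖ * (‖(w : ℂ)‖ + 1) := by
      have e : u * ((ρ 0 : ℝ) : ℂ) - v * ((-ρ 1 : ℝ) : ℂ) = (ρ 0 : ℂ) * u + ρ 1 * v := by
        push_cast
        ring
      rw [e, comb]
      refine (norm_add_le _ _).trans ?_
      rw [norm_mul, Complex.norm_real, Complex.norm_real, mul_add, mul_one]
      gcongr <;> apply norm_le_pi_norm
    have low : ‖σ ᵥ* B.1‖ ≤ K * (2 * ‖σ‖ * P) := by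
      set s := σ ᵥ* B.1
      have h1 : ‖(s 0 : ℂ) * w + s 1‖ ≤ 2 * ‖σ‖ * P := by
        rw [← comb]
        refine (norm_add_le _ _).trans ?_
        rw [norm_mul, norm_mul, Complex.norm_real, Complex.norm_real]
        have a0 := norm_le_pi_norm σ 0
        have a1 := norm_le_pi_norm σ 1
        have := mul_le_mul a0 hu (norm_nonneg _) (norm_nonneg _)
        have := mul_le_mul a1 hv (norm_nonneg _) (norm_nonneg _)
        linarith
      have h2 : |s 0| * w.im ≤ ‖(s 0 : ℂ) * w + s 1‖ := by
        have := Complex.abs_im_le_norm ((s 0 : ℂ) * w + s 1)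
        simpa [abs_mul, abs_of_pos him] using this
      have h3 : |s 1| ≤ ‖(s 0 : ℂ) * w + s 1‖ + |s 0| * ‖(w : ℂ)‖ := by
        have := norm_sub_le ((s 0 : ℂ) * w + s 1) ((s 0 : ℂ) * w)
        simpa using this
      set N := ‖(s 0 : ℂ) * w + s 1‖
      have hN : 0 ≤ N := norm_nonneg _
      have h0 : |s 0| ≤ N / w.im := (le_div_iff₀ him).mpr h2
      have hle : ‖s‖ ≤ K * N := by
        refine (pi_norm_le_iff_of_nonneg (by positivity)).mpr fun i => ?_
        have hw0 : 0 ≤ ‖(w : ℂ)‖ / w.im := by positivity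
        have hN' : 0 ≤ N / w.im := by positivity
        have eK : K * N = N / w.im + N + N / w.im * ‖(w : ℂ)‖ := by rw [hK]; ring
        rw [eK]
        fin_cases i
        · simp only [Fin.zero_eta, Real.norm_eq_abs]
          have : 0 ≤ N / w.im * ‖(w : ℂ)‖ := by positivity
          linarith
        · simp only [Fin.mk_one, Real.norm_eq_abs]
          have : |s 0| * ‖(w : ℂ)‖ ≤ N / w.im * ‖(w : ℂ)‖ := by gcongr
          linarith
      refine hle.trans ?_
      gcongr
    have spos : 0 < ‖σ ᵥ* B.1‖ := by
      apply norm_pos_iff.mpr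
      intro h0
      apply hσ
      have : (σ ᵥ* B.1) ᵥ* (B⁻¹).1 = σ := by
        rw [vecMul_vecMul, ← Matrix.SpecialLinearGroup.coe_mul, mul_inv_cancel]
        simp
      rw [← this, h0, zero_vecMul]
    rw [div_le_iff₀ (by positivity)]
    have e : (2 * (‖(w : ℂ)‖ + 1) * (2 * K * ‖σ‖) / c) * (‖ρ ᵥ* B.1‖ / ‖σ ᵥ* B.1‖) * (P * c) =
        2 * (‖ρ ᵥ* B.1‖ * (‖(w : ℂ)‖ + 1)) * ((K * (2 * ‖σ‖ * P)) / ‖σ ᵥ* B.1‖) := by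
      field_simp
    rw [e]
    have : 1 ≤ (K * (2 * ‖σ‖ * P)) / ‖σ ᵥ* B.1‖ := (one_le_div spos).mpr low
    calc _ ≤ 2 * (‖ρ ᵥ* B.1‖ * (‖(w : ℂ)‖ + 1)) * 1 := by rw [mul_one]; gcongr
      _ ≤ _ := by gcongr
  refine squeeze_zero (fun n => ?_) key (by simpa using h.const_mul _)
  rw [chordal_eq_dist_stereo]
  exact dist_nonneg

/-! ### Partial products and words in the generators -/

/-- The product `f 0 * f 1 * ⋯ * f (n - 1)`. -/
def partialProd {M : Type*} [Monoid M] (f : ℕ → M) : ℕ → M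
  | 0 => 1
  | n + 1 => partialProd f n * f n

theorem partialProd_add {M : Type*} [Monoid M] (f : ℕ → M) (m n : ℕ) :
    partialProd f (m + n) = partialProd f m * partialProd (fun i => f (m + i)) n := by
  induction n with
  | zero => simp [partialProd]
  | succ n ih => rw [← add_assoc, partialProd, ih, partialProd, mul_assoc]

theorem partialProd_succ_mem_closure {M : Type*} [Monoid M] {𝓕 : Set M} {f : ℕ → M}
    (hf : ∀ i, f i ∈ 𝓕) (n : ℕ) : partialProd f (n + 1) ∈ Subsemigroup.closure 𝓕 := by
  induction n with
  | zero => simpa [partialProd] using Subsemigroup.subset_closure (hf 0)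
  | succ n ih => exact mul_mem ih (Subsemigroup.subset_closure (hf _))

theorem inv_mul_partialProd_mem_closure {G : Type*} [Group G] {𝓕 : Set G} {f : ℕ → G}
    (hf : ∀ i, f i ∈ 𝓕) {m n : ℕ} (h : m < n) :
    (partialProd f m)⁻¹ * partialProd f n ∈ Subsemigroup.closure 𝓕 := by
  obtain ⟨k, rfl⟩ := Nat.exists_eq_add_of_lt h
  rw [add_assoc, partialProd_add, inv_mul_cancel_left]
  exact partialProd_succ_mem_closure (fun i => hf _) k

theorem exists_list_of_mem_closure {M : Type*} [Monoid M] {𝓕 : Set M} {t : M}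
    (ht : t ∈ Subsemigroup.closure 𝓕) : ∃ l : List M, l ≠ [] ∧ (∀ x ∈ l, x ∈ 𝓕) ∧ l.prod = t := by
  induction ht using Subsemigroup.closure_induction with
  | mem x hx => exact ⟨[x], by simp, by simpa using hx, by simp⟩
  | mul x y _ _ hx hy =>
    obtain ⟨l, hl, hl', rfl⟩ := hx
    obtain ⟨k, _, hk', rfl⟩ := hy
    refine ⟨l ++ k, by simp [hl], fun z hz => ?_, by simp⟩
    rcases List.mem_append.mp hz with h | h
    exacts [hl' z h, hk' z h]

/-- The partial products of a sequence in the semigroup generated by `𝓕` are among the partial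
products of a sequence in `𝓕`. -/
theorem exists_partialProd_eq {M : Type*} [Monoid M] {𝓕 : Set M} {t : ℕ → M}
    (ht : ∀ k, t k ∈ Subsemigroup.closure 𝓕) :
    ∃ f : ℕ → M, (∀ i, f i ∈ 𝓕) ∧ ∀ k, ∃ n ≥ k, partialProd f n = partialProd t k := by
  choose l hl0 hl hlp using fun k => exists_list_of_mem_closure (ht k)
  -- `L k` concatenates the first `k` words. The words are nonempty, so `L (n + 1)` is long enough
  -- to have an entry at index `n`.
  let L : ℕ → List M := fun k => Nat.rec [] (fun k r => r ++ l k) k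
  have Ls : ∀ k, L (k + 1) = L k ++ l k := fun k => rfl
  have hpre : ∀ k m, L k <+: L (k + m) := by
    intro k m
    induction m with
    | zero => exact List.prefix_refl _
    | succ m ih => exact ih.trans (by rw [← add_assoc, Ls]; exact List.prefix_append _ _)
  have hlen : ∀ k, k ≤ (L k).length := by
    intro k
    induction k with
    | zero => simp
    | succ k ih =>
      have := List.length_pos_iff.mpr (hl0 k)
      rw [Ls, List.length_append]
      omega
  have hmem : ∀ k, ∀ x ∈ L k, x ∈ 𝓕 := by
    intro k
    induction k with
    | zero => simp [L]
    | succ k ih =>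
      intro x hx
      rw [Ls] at hx
      rcases List.mem_append.mp hx with h | h
      exacts [ih x h, hl k x h]
  have hprod : ∀ k, (L k).prod = partialProd t k := by
    intro k
    induction k with
    | zero => simp [L, partialProd]
    | succ k ih => rw [Ls, List.prod_append, ih, hlp, partialProd]
  have hn : ∀ n, n < (L (n + 1)).length := fun n => hlen (n + 1)
  let f : ℕ → M := fun n => (L (n + 1))[n]'(hn n)
  have hf : ∀ k n (h : n < (L k).length), f n = (L k)[n] := by
    intro k n h
    rcases le_total k (n + 1) with hk | hk
    · obtain ⟨m, hm⟩ := Nat.exists_eq_add_of_le hk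
      have hp : L k <+: L (n + 1) := hm ▸ hpre k m
      exact (hp.getElem h).symm
    · obtain ⟨m, rfl⟩ := Nat.exists_eq_add_of_le hk
      exact (hpre (n + 1) m).getElem (hn n)
  have hpart : ∀ k n, n ≤ (L k).length → partialProd f n = ((L k).take n).prod := by
    intro k n
    induction n with
    | zero => simp [partialProd]
    | succ n ih =>
      intro h
      rw [partialProd, ih (by omega), hf k n h, List.prod_take_succ]
  refine ⟨f, fun i => hmem (i + 1) _ (List.getElem_mem _), fun k => ⟨(L k).length, hlen k, ?_⟩⟩
  rw [hpart k _ le_rfl, List.take_length, hprod]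

/-! ### Escape and the identity in the closure -/

/-- Every sequence of partial products of elements of `𝓖` leaves every bounded subset of the
hyperbolic plane. -/
def Escapes (𝓖 : Set SL(2, ℝ)) : Prop :=
  ∀ f : ℕ → SL(2, ℝ), (∀ i, f i ∈ 𝓖) →
    Tendsto (fun n => dist (partialProd f n • UpperHalfPlane.I) UpperHalfPlane.I) atTop atTop

/-- Expanding each factor into generators turns these products into a subsequence of a genuine
composition sequence, so escape is contradicted by bounded products of arbitrary semigroup elements.
-/
theorem Escapes.not_bounded {𝓖 : Set SL(2, ℝ)} (h : Escapes 𝓖) {t : ℕ → SL(2, ℝ)}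
    (ht : ∀ k, t k ∈ Subsemigroup.closure 𝓖) (R : ℝ) :
    ¬ ∀ k, dist (partialProd t k • UpperHalfPlane.I) UpperHalfPlane.I ≤ R := by
  intro hb
  obtain ⟨f, hf, hn⟩ := exists_partialProd_eq ht
  obtain ⟨N, hN⟩ := eventually_atTop.mp ((h f hf).eventually_gt_atTop R)
  obtain ⟨n, hn, he⟩ := hn N
  have := hN n hn
  rw [he] at this
  exact this.not_ge (hb N)

/-- Elements with summable displacements of `I` would multiply to a bounded orbit, since the
displacements add up along it. -/
theorem Escapes.exists_le_dist {𝓖 : Set SL(2, ℝ)} (h : Escapes 𝓖) :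
    ∃ ε > 0, ∀ t ∈ Subsemigroup.closure 𝓖,
      ε ≤ dist (t • UpperHalfPlane.I) UpperHalfPlane.I := by
  by_contra! hc
  choose t ht htd using fun k : ℕ => hc ((1 / 2) ^ k) (by positivity)
  refine h.not_bounded ht 2 fun k => ?_
  -- The right-hand side is the sum of `2⁻ʲ` over `j < k`.
  suffices dist (partialProd t k • UpperHalfPlane.I) UpperHalfPlane.I ≤ 2 - 2 * (1 / 2) ^ k by
    have : (0 : ℝ) < (1 / 2) ^ k := by positivity
    linarith
  induction k with
  | zero => simp [partialProd]
  | succ k ih =>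
    have h1 := dist_triangle (partialProd t (k + 1) • UpperHalfPlane.I)
      (partialProd t k • UpperHalfPlane.I) UpperHalfPlane.I
    rw [partialProd, mul_smul, dist_smul] at h1
    have := htd k
    rw [partialProd, mul_smul, pow_succ]
    linarith

theorem im_smul_I (A : SL(2, ℝ)) :
    (A • UpperHalfPlane.I).im = 1 / (A 1 0 ^ 2 + A 1 1 ^ 2) := by
  have hd := SL2_det A
  rw [← UpperHalfPlane.coe_im, UpperHalfPlane.coe_specialLinearGroup_apply, Complex.div_im]
  simp [Complex.normSq_apply]
  rw [← sub_div, hd, one_div]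
  congr 1
  ring

theorem re_smul_I (A : SL(2, ℝ)) : (A • UpperHalfPlane.I).re =
    (A 0 0 * A 1 0 + A 0 1 * A 1 1) / (A 1 0 ^ 2 + A 1 1 ^ 2) := by
  rw [← UpperHalfPlane.coe_re, UpperHalfPlane.coe_specialLinearGroup_apply, Complex.div_re]
  simp [Complex.normSq_apply]
  rw [← add_div]
  congr 1
  · ring
  · ring

theorem sq_add_sq_pos_of_SL2 (A : SL(2, ℝ)) : 0 < A 1 0 ^ 2 + A 1 1 ^ 2 := by
  have hd := SL2_det A
  by_contra hc
  have h0 : A 1 0 = 0 := by nlinarith [sq_nonneg (A 1 0), sq_nonneg (A 1 1)]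
  have h1 : A 1 1 = 0 := by nlinarith [sq_nonneg (A 1 0), sq_nonneg (A 1 1)]
  simp [h0, h1] at hd

/-- The sum of the squared entries measures the displacement of `I`, so a bounded orbit means
bounded matrices and conversely. -/
theorem cosh_dist_smul_I (A : SL(2, ℝ)) :
    Real.cosh (dist (A • UpperHalfPlane.I) UpperHalfPlane.I) =
      (A 0 0 ^ 2 + A 0 1 ^ 2 + A 1 0 ^ 2 + A 1 1 ^ 2) / 2 := by
  have hd := SL2_det A
  have hq := sq_add_sq_pos_of_SL2 A
  rw [UpperHalfPlane.cosh_dist, dist_eq_norm, Complex.sq_norm, Complex.normSq_apply]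
  simp only [Complex.sub_re, Complex.sub_im, UpperHalfPlane.coe_re, UpperHalfPlane.coe_im,
    im_smul_I, re_smul_I, UpperHalfPlane.I_re, UpperHalfPlane.I_im]
  field_simp
  linear_combination (-(A 0 0 * A 1 1 - A 0 1 * A 1 0) - 1) * hd

/-- If the identity is not in the closure of the semigroup generated by `𝓖`, then all sequences of
partial products escape. -/
theorem escapes_of_nhds_one {𝓖 : Set SL(2, ℝ)}
    (h : ∀ᶠ A in 𝓝 (1 : SL(2, ℝ)), A ∉ Subsemigroup.closure 𝓖) : Escapes 𝓖 := by
  intro f hf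
  by_contra hT
  rw [tendsto_atTop] at hT
  push Not at hT
  obtain ⟨R, hR⟩ := hT
  set C := √(2 * Real.cosh R)
  have hK : IsCompact {A : SL(2, ℝ) | ∀ i j, A i j ∈ Set.Icc (-C) C} :=
    Matrix.SpecialLinearGroup.isClosedEmbedding_val.isCompact_preimage
      (isCompact_pi_infinite fun _ => isCompact_pi_infinite fun _ => isCompact_Icc)
  have hfr : ∃ᶠ n in atTop, partialProd f n ∈ {A : SL(2, ℝ) | ∀ i j, A i j ∈ Set.Icc (-C) C} := by
    refine hR.mono fun n hn => ?_
    set A := partialProd f n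
    have hc := cosh_dist_smul_I A
    have : Real.cosh (dist (A • UpperHalfPlane.I) UpperHalfPlane.I) ≤ Real.cosh R := by
      rw [Real.cosh_le_cosh, abs_of_nonneg dist_nonneg]
      exact hn.le.trans (le_abs_self R)
    intro i j
    rw [Set.mem_Icc, ← abs_le]
    apply Real.abs_le_sqrt
    fin_cases i <;> fin_cases j <;> simp <;>
      nlinarith [sq_nonneg (A 0 0), sq_nonneg (A 0 1), sq_nonneg (A 1 0), sq_nonneg (A 1 1)]
  obtain ⟨B, -, hB⟩ := hK.exists_mapClusterPt_of_frequently hfr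
  have hcont : Tendsto (fun p : SL(2, ℝ) × SL(2, ℝ) => p.1⁻¹ * p.2) (𝓝 B ×ˢ 𝓝 B) (𝓝 1) := by
    have : Continuous fun p : SL(2, ℝ) × SL(2, ℝ) => p.1⁻¹ * p.2 := by fun_prop
    have := this.tendsto (B, B)
    rwa [nhds_prod_eq, inv_mul_cancel] at this
  obtain ⟨U, hU, hUV⟩ := (eventually_prod_self_iff
    (r := fun x y => x⁻¹ * y ∉ Subsemigroup.closure 𝓖)).mp (hcont.eventually h)
  have hBf := hB.frequently hU
  obtain ⟨m, -, hm⟩ := frequently_atTop.mp hBf 0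
  -- Starting from `m + 1` makes the block between `m` and `n` nonempty, hence an element of the
  -- semigroup.
  obtain ⟨n, hmn, hn⟩ := frequently_atTop.mp hBf (m + 1)
  exact hUV _ hm _ hn (inv_mul_partialProd_mem_closure hf hmn)

/-! ### A row vector that the semigroup cannot contract -/

open Matrix

theorem norm_vecMul_le {A : Matrix (Fin 2) (Fin 2) ℝ} {M : ℝ} (h : ∀ i j, |A i j| ≤ M)
    (v : Fin 2 → ℝ) : ‖v ᵥ* A‖ ≤ 2 * M * ‖v‖ := by
  have hM : 0 ≤ M := (abs_nonneg _).trans (h 0 0)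
  refine (pi_norm_le_iff_of_nonneg (by positivity)).mpr fun j => ?_
  simp only [vecMul, dotProduct, Fin.sum_univ_two]
  refine (norm_add_le _ _).trans ?_
  have h0 := mul_le_mul (norm_le_pi_norm v 0) (h 0 j) (abs_nonneg _) (norm_nonneg _)
  have h1 := mul_le_mul (norm_le_pi_norm v 1) (h 1 j) (abs_nonneg _) (norm_nonneg _)
  simp only [norm_mul, Real.norm_eq_abs] at *
  linarith

theorem dist_smul_I_le {A : SL(2, ℝ)} {K : ℝ} (h : ∀ i, ‖A.1 i‖ ≤ K) :
    dist (A • UpperHalfPlane.I) UpperHalfPlane.I ≤ 4 * K ^ 2 := by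
  have hc := cosh_dist_smul_I A
  set d := dist (A • UpperHalfPlane.I) UpperHalfPlane.I
  have h1 : d ≤ 2 * Real.cosh d := by
    rw [Real.cosh_eq]
    linarith [Real.add_one_le_exp d, Real.exp_pos (-d)]
  have key : ∀ i j, A i j ^ 2 ≤ K ^ 2 := fun i j =>
    sq_le_sq' (abs_le.mp ((norm_le_pi_norm (A.1 i) j).trans (h i))).1
      (abs_le.mp ((norm_le_pi_norm (A.1 i) j).trans (h i))).2
  linarith [key 0 0, key 0 1, key 1 0, key 1 1]

theorem sq_norm_le_sq_add_sq (v : Fin 2 → ℝ) : ‖v‖ ^ 2 ≤ v 0 ^ 2 + v 1 ^ 2 := by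
  have : ‖v‖ ≤ √(v 0 ^ 2 + v 1 ^ 2) := by
    refine (pi_norm_le_iff_of_nonneg (by positivity)).mpr fun i => ?_
    apply Real.abs_le_sqrt
    fin_cases i <;> simp [sq_nonneg]
  calc ‖v‖ ^ 2 ≤ √(v 0 ^ 2 + v 1 ^ 2) ^ 2 := by gcongr
    _ = _ := Real.sq_sqrt (by positivity)

theorem sq_add_sq_le_two_mul_sq_norm (v : Fin 2 → ℝ) : v 0 ^ 2 + v 1 ^ 2 ≤ 2 * ‖v‖ ^ 2 := by
  have h : ∀ i, v i ^ 2 ≤ ‖v‖ ^ 2 := fun i =>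
    sq_le_sq' (abs_le.mp (norm_le_pi_norm v i)).1 (abs_le.mp (norm_le_pi_norm v i)).2
  linarith [h 0, h 1]

/-- A matrix that contracts the larger one of two row vectors spanning a unit area does not enlarge
the other one much. -/
theorem norm_vecMul_le_max {v w : Fin 2 → ℝ} (hdet : |v 0 * w 1 - v 1 * w 0| = 1)
    (hwv : ‖w‖ ≤ ‖v‖) {A : Matrix (Fin 2) (Fin 2) ℝ} {M : ℝ} (hM : 1 ≤ M)
    (hA : ∀ i j, |A i j| ≤ M) (hv : ‖v ᵥ* A‖ ≤ 1 / 4 * ‖v‖) :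
    ‖v ᵥ* A‖ ≤ max ‖v‖ (6 * M) ∧ ‖w ᵥ* A‖ ≤ max ‖v‖ (6 * M) := by
  refine ⟨le_max_of_le_left (by linarith [norm_nonneg v]), ?_⟩
  set q := v 0 ^ 2 + v 1 ^ 2 with hq
  have hq1 : ‖v‖ ^ 2 ≤ q := sq_norm_le_sq_add_sq v
  have hv2 : 1 / 2 ≤ ‖v‖ ^ 2 := by
    have h1 : |v 0 * w 1 - v 1 * w 0| ≤ |v 0| * |w 1| + |v 1| * |w 0| := by
      simpa [abs_mul] using abs_sub (v 0 * w 1) (v 1 * w 0)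
    have h2 := mul_le_mul (norm_le_pi_norm v 0) ((norm_le_pi_norm w 1).trans hwv)
      (abs_nonneg _) (norm_nonneg _)
    have h3 := mul_le_mul (norm_le_pi_norm v 1) ((norm_le_pi_norm w 0).trans hwv)
      (abs_nonneg _) (norm_nonneg _)
    simp only [Real.norm_eq_abs] at h2 h3
    nlinarith
  have hvpos : 1 / 2 ≤ ‖v‖ := by nlinarith [norm_nonneg v]
  have hqpos : 0 < q := by linarith
  set α := (v 0 * w 0 + v 1 * w 1) / q with hα
  set β := (v 0 * w 1 - v 1 * w 0) / q with hβ
  -- Split `w` along `v` and its quarter turn. The unit area makes the second coefficient at most `1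
  -- / ‖v‖ ^ 2`, so the image of `w` has norm at most `‖v‖ / 2 + 2 M / ‖v‖`.
  have hw : w = α • v + β • ![-v 1, v 0] := by
    ext i
    fin_cases i <;> simp [hα, hβ] <;> field_simp <;> ring
  have hαle : |α| ≤ 2 := by
    rw [hα, abs_div, abs_of_pos hqpos, div_le_iff₀ hqpos]
    have h1 : |v 0 * w 0 + v 1 * w 1| ≤ |v 0| * |w 0| + |v 1| * |w 1| := by
      simpa [abs_mul] using abs_add_le (v 0 * w 0) (v 1 * w 1)
    have h2 := mul_le_mul (norm_le_pi_norm v 0) ((norm_le_pi_norm w 0).trans hwv)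
      (abs_nonneg _) (norm_nonneg _)
    have h3 := mul_le_mul (norm_le_pi_norm v 1) ((norm_le_pi_norm w 1).trans hwv)
      (abs_nonneg _) (norm_nonneg _)
    simp only [Real.norm_eq_abs] at h2 h3
    nlinarith
  have hβle : |β| ≤ 1 / ‖v‖ ^ 2 := by
    rw [hβ, abs_div, hdet, abs_of_pos hqpos]
    exact one_div_le_one_div_of_le (by positivity) hq1
  have hJ : ‖![-v 1, v 0]‖ ≤ ‖v‖ := by
    refine (pi_norm_le_iff_of_nonneg (norm_nonneg _)).mpr fun i => ?_
    fin_cases i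
    · simpa using norm_le_pi_norm v 1
    · simpa using norm_le_pi_norm v 0
  have hb : ‖w ᵥ* A‖ ≤ 1 / 2 * ‖v‖ + 2 * M / ‖v‖ := by
    rw [hw, add_vecMul, smul_vecMul, smul_vecMul]
    refine (norm_add_le _ _).trans ?_
    rw [norm_smul, norm_smul, Real.norm_eq_abs, Real.norm_eq_abs]
    have h1 := norm_vecMul_le hA ![-v 1, v 0]
    have h2 : |β| * ‖![-v 1, v 0] ᵥ* A‖ ≤ 1 / ‖v‖ ^ 2 * (2 * M * ‖v‖) := by
      gcongr
      exact h1.trans (by gcongr)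
    have h3 : |α| * ‖v ᵥ* A‖ ≤ 2 * (1 / 4 * ‖v‖) := by gcongr
    have h4 : 1 / ‖v‖ ^ 2 * (2 * M * ‖v‖) = 2 * M / ‖v‖ := by field_simp
    linarith
  refine hb.trans ?_
  -- For long `v` the second term is at most `‖v‖ / 2`; for short `v` the bound `‖v‖ ≥ 1/2` gives `2
  -- M + 4 M`.
  rcases le_total (4 * M) ‖v‖ with h | h
  · refine le_max_of_le_left ?_
    have : 2 * M / ‖v‖ ≤ 1 / 2 * ‖v‖ := by
      rw [div_le_iff₀ (by linarith)]
      nlinarith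
    linarith
  · refine le_max_of_le_right ?_
    have : 2 * M / ‖v‖ ≤ 4 * M := by
      rw [div_le_iff₀ (by linarith)]
      nlinarith
    linarith

/-- If every row vector can be contracted arbitrarily by a set `T` of matrices, then compactness
yields a uniform contraction by a bounded subset of `T`. -/
theorem exists_uniform_contraction {T : Set SL(2, ℝ)}
    (h : ∀ r : Fin 2 → ℝ, r ≠ 0 → ∀ ε > 0, ∃ t ∈ T, ‖r ᵥ* t.1‖ < ε) :
    ∃ M : ℝ, 1 ≤ M ∧ ∀ r : Fin 2 → ℝ, r ≠ 0 →
      ∃ t ∈ T, ‖r ᵥ* t.1‖ ≤ 1 / 4 * ‖r‖ ∧ ∀ i j, |t i j| ≤ M := by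
  suffices H : ∃ M : ℝ, ∀ r ∈ Metric.sphere (0 : Fin 2 → ℝ) 1,
      ∃ t ∈ T, ‖r ᵥ* t.1‖ ≤ 1 / 4 ∧ ∀ i j, |t i j| ≤ M by
    obtain ⟨M, hM⟩ := H
    refine ⟨max 1 M, le_max_left _ _, fun r hr => ?_⟩
    have hr' : 0 < ‖r‖ := norm_pos_iff.mpr hr
    obtain ⟨t, ht, h1, h2⟩ := hM (‖r‖⁻¹ • r) (by simp [norm_smul, hr'.ne'])
    refine ⟨t, ht, ?_, fun i j => (h2 i j).trans (le_max_right _ _)⟩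
    rw [smul_vecMul, norm_smul, norm_inv, norm_norm, inv_mul_le_iff₀ hr'] at h1
    linarith
  refine (isCompact_sphere (0 : Fin 2 → ℝ) 1).induction_on
    (p := fun s => ∃ M : ℝ, ∀ r ∈ s, ∃ t ∈ T, ‖r ᵥ* t.1‖ ≤ 1 / 4 ∧ ∀ i j, |t i j| ≤ M)
    ⟨0, by simp⟩ (fun s s' hs ⟨M, hM⟩ => ⟨M, fun r hr => hM r (hs hr)⟩) ?_ ?_
  · rintro s s' ⟨M, hM⟩ ⟨M', hM'⟩
    refine ⟨max M M', ?_⟩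
    rintro r (hr | hr)
    · obtain ⟨t, ht, h1, h2⟩ := hM r hr
      exact ⟨t, ht, h1, fun i j => (h2 i j).trans (le_max_left _ _)⟩
    · obtain ⟨t, ht, h1, h2⟩ := hM' r hr
      exact ⟨t, ht, h1, fun i j => (h2 i j).trans (le_max_right _ _)⟩
  · intro r hr
    obtain ⟨t, ht, hlt⟩ := h r (ne_zero_of_mem_unit_sphere ⟨r, hr⟩) (1 / 4) (by norm_num)
    have hcont : Continuous fun r : Fin 2 → ℝ => ‖r ᵥ* t.1‖ := by fun_prop
    refine ⟨{r | ‖r ᵥ* t.1‖ < 1 / 4}, mem_nhdsWithin_of_mem_nhds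
      ((isOpen_lt hcont continuous_const).mem_nhds hlt), ?_⟩
    refine ⟨max (max |t 0 0| |t 0 1|) (max |t 1 0| |t 1 1|), fun r hr => ⟨t, ht, ?_, ?_⟩⟩
    · exact (show ‖r ᵥ* t.1‖ < 1 / 4 from hr).le
    · intro i j
      fin_cases i <;> fin_cases j <;> simp

/-- If all sequences of partial products escape, then there is a row vector that the semigroup does
not contract to zero. -/
theorem Escapes.exists_row {𝓖 : Set SL(2, ℝ)} (h : Escapes 𝓖) :
    ∃ r : Fin 2 → ℝ, r ≠ 0 ∧ ∃ ε > 0, ∀ t ∈ Subsemigroup.closure 𝓖, ε ≤ ‖r ᵥ* t.1‖ := by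
  by_contra! hc
  obtain ⟨M, hM1, hM⟩ := exists_uniform_contraction (T := Subsemigroup.closure 𝓖) hc
  -- Greedy choice: contract the longer row of the current product. The bound `6 M` on both rows is
  -- then preserved.
  have step : ∀ G : SL(2, ℝ), ∃ t ∈ Subsemigroup.closure 𝓖,
      (∀ i, ‖G.1 i‖ ≤ 6 * M) → ∀ i, ‖(G * t).1 i‖ ≤ 6 * M := by
    intro G
    have hdet := SL2_det G
    have hne : ∀ i, G.1 i ≠ 0 := by
      intro i hi
      have h0 := congrFun hi 0
      have h1 := congrFun hi 1
      fin_cases i <;> simp at h0 h1 <;> simp [h0, h1] at hdet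
    have row : ∀ (t : SL(2, ℝ)) i, (G * t).1 i = G.1 i ᵥ* t.1 := fun t i => by
      rw [Matrix.SpecialLinearGroup.coe_mul, Matrix.mul_apply_eq_vecMul]
    rcases le_total ‖G.1 1‖ ‖G.1 0‖ with hle | hle
    · obtain ⟨t, ht, hlt, htM⟩ := hM _ (hne 0)
      refine ⟨t, ht, fun hb => ?_⟩
      have := norm_vecMul_le_max (v := G.1 0) (w := G.1 1) (by rw [hdet, abs_one]) hle hM1 htM hlt
      rw [max_eq_right (hb 0)] at this
      rw [Fin.forall_fin_two, row, row]
      exact this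
    · obtain ⟨t, ht, hlt, htM⟩ := hM _ (hne 1)
      refine ⟨t, ht, fun hb => ?_⟩
      have := norm_vecMul_le_max (v := G.1 1) (w := G.1 0)
        (by rw [abs_eq (by norm_num)]; right; linarith) hle hM1 htM hlt
      rw [max_eq_right (hb 1)] at this
      rw [Fin.forall_fin_two, row, row]
      exact this.symm
  choose τ hτ hτb using step
  let G : ℕ → SL(2, ℝ) := fun k => Nat.rec 1 (fun _ g => g * τ g) k
  have hG : ∀ k, partialProd (fun k => τ (G k)) k = G k := by
    intro k
    induction k with
    | zero => rfl
    | succ k ih => rw [partialProd, ih]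
  have hGb : ∀ k i, ‖(G k).1 i‖ ≤ 6 * M := by
    intro k
    induction k with
    | zero =>
      intro i
      refine (pi_norm_le_iff_of_nonneg (by linarith)).mpr fun j => ?_
      change ‖(1 : Matrix (Fin 2) (Fin 2) ℝ) i j‖ ≤ _
      rw [Matrix.one_apply]
      split_ifs <;> simp <;> linarith
    | succ k ih => exact hτb (G k) ih
  refine h.not_bounded (t := fun k => τ (G k)) (fun k => hτ _) (4 * (6 * M) ^ 2) fun k => ?_
  rw [hG]
  exact dist_smul_I_le (hGb k)

/-! ### Sequences in the upper half-plane -/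

theorem dist_I_le {z : ℍ} {R η : ℝ} (hη : 0 < η) (hz : ‖(z : ℂ)‖ ≤ R) (him : η ≤ z.im) :
    dist z UpperHalfPlane.I ≤ 2 * (1 + (R + 1) ^ 2 / (2 * η)) := by
  have hc := UpperHalfPlane.cosh_dist z UpperHalfPlane.I
  have hd : dist (z : ℂ) UpperHalfPlane.I ≤ R + 1 := by
    rw [dist_eq_norm]
    refine (norm_sub_le _ _).trans ?_
    simpa using hz
  have : dist (z : ℂ) UpperHalfPlane.I ^ 2 / (2 * z.im * UpperHalfPlane.I.im) ≤
      (R + 1) ^ 2 / (2 * η) := by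
    rw [UpperHalfPlane.I_im, mul_one]
    gcongr
  set d := dist z UpperHalfPlane.I
  have h1 : d ≤ 2 * Real.cosh d := by
    rw [Real.cosh_eq]
    linarith [Real.add_one_le_exp d, Real.exp_pos (-d)]
  linarith

theorem norm_coe_le (z : ℍ) : ‖(z : ℂ)‖ ≤ |z.re| + z.im := by
  have := Complex.norm_le_abs_re_add_abs_im (z : ℂ)
  rwa [UpperHalfPlane.coe_re, UpperHalfPlane.coe_im, abs_of_pos z.im_pos] at this

theorem eventually_im_lt {z : ℕ → ℍ}
    (h : Tendsto (fun n => dist (z n) UpperHalfPlane.I) atTop atTop) (R : ℝ) {η : ℝ}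
    (hη : 0 < η) : ∀ᶠ n in atTop, ‖(z n : ℂ)‖ ≤ R → (z n).im < η := by
  filter_upwards [h.eventually_gt_atTop (2 * (1 + (R + 1) ^ 2 / (2 * η)))] with n hn hz
  by_contra! hc
  exact hn.not_ge (dist_I_le hη hz hc)

theorem exists_crossing {P : ℕ → Prop} {m n : ℕ} (hmn : m ≤ n) (hm : P m) (hn : ¬ P n) :
    ∃ k ≥ m, P k ∧ ¬ P (k + 1) := by
  by_contra! hc
  exact hn (Nat.le_induction hm (fun k hk h => hc k hk h) n hmn)

/-- An escaping sequence with bounded steps and bounded height whose real parts oscillate about `x`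
enters every horodisc based at `x`. -/
theorem frequently_mem_horodisc {z : ℕ → ℍ}
    (h : Tendsto (fun n => dist (z n) UpperHalfPlane.I) atTop atTop) {C K x : ℝ}
    (hC : ∀ n, (z n).im ≤ C) (hK : ∀ n, dist (z (n + 1) : ℂ) (z n) ≤ K * (z n).im)
    (h1 : ∃ᶠ n in atTop, (z n).re < x) (h2 : ∃ᶠ n in atTop, x < (z n).re) {δ : ℝ} (hδ : 0 < δ) :
    ∃ᶠ n in atTop, ((z n).re - x) ^ 2 + (z n).im ^ 2 < δ * (z n).im := by
  have hK0 : 0 ≤ K := by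
    have := dist_nonneg.trans (hK 0)
    exact nonneg_of_mul_nonneg_left this (z 0).im_pos
  rw [frequently_atTop]
  intro N
  obtain ⟨N', hN'⟩ := eventually_atTop.mp
    (eventually_im_lt h (|x| + K * C + C) (η := δ / (K ^ 2 + 1)) (by positivity))
  obtain ⟨m, hm, hmx⟩ := frequently_atTop.mp h1 (max N N')
  obtain ⟨l, hl, hlx⟩ := frequently_atTop.mp h2 m
  -- At a crossing the horizontal distance to `x` is at most one step, hence at most `K` times the
  -- height. Escape makes the height less than `δ / (K ^ 2 + 1)`, which is what the horodisc
  -- requires.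
  obtain ⟨k, hk, hkx, hkx'⟩ := exists_crossing (P := fun n => (z n).re < x) hl hmx hlx.not_gt
  have hkN : max N N' ≤ k := hm.trans hk
  refine ⟨k, (le_max_left _ _).trans hkN, ?_⟩
  have him := (z k).im_pos
  have hd : |(z k).re - x| ≤ K * (z k).im := by
    refine le_trans ?_ (hK k)
    rw [dist_eq_norm]
    have h3 := (le_abs_self _).trans (Complex.abs_re_le_norm ((z (k + 1) : ℂ) - z k))
    simp only [Complex.sub_re, UpperHalfPlane.coe_re] at h3
    simp only [not_lt] at hkx'
    rw [abs_of_neg (by linarith)]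
    linarith
  have hlt : (z k).im < δ / (K ^ 2 + 1) := by
    refine hN' k ((le_max_right _ _).trans hkN) ((norm_coe_le _).trans ?_)
    have h4 : |(z k).re| ≤ |(z k).re - x| + |x| := by
      simpa using abs_add_le ((z k).re - x) x
    have h5 : K * (z k).im ≤ K * C := mul_le_mul_of_nonneg_left (hC k) hK0
    linarith [hC k]
  rw [lt_div_iff₀ (by positivity)] at hlt
  have h6 : ((z k).re - x) ^ 2 ≤ (K * (z k).im) ^ 2 := by
    rw [← sq_abs]
    gcongr
  nlinarith

/-- In the extended reals, absence of upcrossings gives a limit without any boundedness assumption.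
-/
theorem exists_tendsto_or_of_no_oscillation {u : ℕ → ℝ}
    (h : ∀ a b, a < b → ¬ ((∃ᶠ n in atTop, u n < a) ∧ ∃ᶠ n in atTop, b < u n)) :
    (∃ x, Tendsto u atTop (𝓝 x)) ∨ Tendsto (fun n => |u n|) atTop atTop := by
  obtain ⟨x, hx⟩ : ∃ x : EReal, Tendsto (fun n => (u n : EReal)) atTop (𝓝 x) := by
    refine tendsto_of_no_upcrossings (s := Set.range ((↑) : ℝ → EReal))
      (EReal.denseRange_ratCast.mono (by rintro _ ⟨q, rfl⟩; exact ⟨q, rfl⟩)) ?_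
    rintro _ ⟨a, rfl⟩ _ ⟨b, rfl⟩ hab
    have := h a b (EReal.coe_lt_coe_iff.mp hab)
    simpa only [EReal.coe_lt_coe_iff] using this
  induction x using EReal.rec with
  | bot => exact Or.inr (tendsto_abs_atBot_atTop.comp (EReal.tendsto_coe_nhds_bot_iff.mp hx))
  | coe x => exact Or.inl ⟨x, EReal.tendsto_coe.mp hx⟩
  | top => exact Or.inr (tendsto_abs_atTop_atTop.comp (EReal.tendsto_coe_nhds_top_iff.mp hx))

/-- A drop of `x` from above `b` to below `a` costs a drop of `K * y` by at least `b - a`, which is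
impossible late because `y` converges. -/
theorem not_oscillating_of_monotone {x y : ℕ → ℝ} {K : ℝ} (hK : 0 ≤ K) (hy : Antitone y)
    (hy0 : ∀ n, 0 ≤ y n) (hx : Monotone fun n => x n - K * y n) {a b : ℝ} (hab : a < b) :
    ¬ ((∃ᶠ n in atTop, x n < a) ∧ ∃ᶠ n in atTop, b < x n) := by
  rintro ⟨h1, h2⟩
  have hlim := tendsto_atTop_ciInf hy ⟨0, by rintro _ ⟨n, rfl⟩; exact hy0 n⟩
  obtain ⟨N, hN⟩ := Metric.cauchySeq_iff.mp hlim.cauchySeq ((b - a) / (K + 1))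
    (div_pos (by linarith) (by linarith))
  obtain ⟨n, hn, hnb⟩ := frequently_atTop.mp h2 N
  obtain ⟨m, hm, hma⟩ := frequently_atTop.mp h1 n
  have hd := hN n hn m (hn.trans hm)
  rw [Real.dist_eq, abs_of_nonneg (sub_nonneg.mpr (hy hm)), lt_div_iff₀ (by linarith)] at hd
  have := hx hm
  simp only at this
  nlinarith [hy hm]

/-! ### Rows and points of the upper half-plane -/

/-- The row `C₀ - x C₁` is short exactly when `C • I` lies in a small horodisc based at `x`;
`row_one` is the analogue for infinity. -/
theorem row_horodisc (C : SL(2, ℝ)) (x : ℝ) :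
    ((C.1 0 - x • C.1 1) 0 ^ 2 + (C.1 0 - x • C.1 1) 1 ^ 2) * (C • UpperHalfPlane.I).im =
      ((C • UpperHalfPlane.I).re - x) ^ 2 + (C • UpperHalfPlane.I).im ^ 2 := by
  have hd := SL2_det C
  have hq := sq_add_sq_pos_of_SL2 C
  rw [im_smul_I, re_smul_I]
  simp only [Pi.sub_apply, Pi.smul_apply, smul_eq_mul]
  field_simp
  linear_combination (C 0 0 * C 1 1 - C 0 1 * C 1 0 + 1) * hd

theorem row_one (C : SL(2, ℝ)) :
    (C.1 1 0 ^ 2 + C.1 1 1 ^ 2) * (C • UpperHalfPlane.I).im = 1 := by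
  have hq := sq_add_sq_pos_of_SL2 C
  rw [im_smul_I]
  field_simp

theorem row_mul (B A : SL(2, ℝ)) (i : Fin 2) : (B * A).1 i = B.1 i ᵥ* A.1 := by
  rw [Matrix.SpecialLinearGroup.coe_mul, Matrix.mul_apply_eq_vecMul]

theorem tendsto_norm_div_of_sq {u v : ℕ → Fin 2 → ℝ} {g : ℕ → ℝ} (hg : Tendsto g atTop (𝓝 0))
    (h : ∀ᶠ n in atTop, u n 0 ^ 2 + u n 1 ^ 2 ≤ g n * (v n 0 ^ 2 + v n 1 ^ 2)) :
    Tendsto (fun n => ‖u n‖ / ‖v n‖) atTop (𝓝 0) := by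
  have hlim : Tendsto (fun n => √(2 * |g n|)) atTop (𝓝 0) := by
    have := (hg.abs.const_mul 2).sqrt
    rwa [abs_zero, mul_zero, Real.sqrt_zero] at this
  refine squeeze_zero' (Eventually.of_forall fun n => by positivity) ?_ hlim
  filter_upwards [h] with n hn
  apply Real.le_sqrt_of_sq_le
  rw [div_pow]
  refine div_le_of_le_mul₀ (by positivity) (by positivity) ?_
  have h1 := sq_norm_le_sq_add_sq (u n)
  have h2 := sq_add_sq_le_two_mul_sq_norm (v n)
  have h3 := mul_le_mul_of_nonneg_left h2 (abs_nonneg (g n))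
  have h4 : g n * (v n 0 ^ 2 + v n 1 ^ 2) ≤ |g n| * (v n 0 ^ 2 + v n 1 ^ 2) := by
    gcongr
    exact le_abs_self _
  linarith

/-- If the points `(B * A n) • I` escape with bounded height and their real parts do not oscillate,
then `A n` converges pointwise to a point of the extended real line. -/
theorem exists_tendsto_chordal_of_no_oscillation {A : ℕ → SL(2, ℝ)} {B : SL(2, ℝ)}
    (hesc : Tendsto (fun n => dist ((B * A n) • UpperHalfPlane.I) UpperHalfPlane.I) atTop atTop)
    {C : ℝ} (hC : ∀ n, ((B * A n) • UpperHalfPlane.I).im ≤ C)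
    (hosc : ∀ a b, a < b → ¬ ((∃ᶠ n in atTop, ((B * A n) • UpperHalfPlane.I).re < a) ∧
      ∃ᶠ n in atTop, b < ((B * A n) • UpperHalfPlane.I).re)) :
    ∃ p ∈ extendedReals, ∀ w : ℍ,
      Tendsto (fun n => chordal (toMob (A n) (ofH w)) p) atTop (𝓝 0) := by
  have hdet := SL2_det B
  have hB1 : B.1 1 ≠ 0 := fun h0 => by
    have h1 := congrFun h0 0
    have h2 := congrFun h0 1
    simp at h1 h2
    simp [h1, h2] at hdet
  have hBx : ∀ x : ℝ, B.1 0 - x • B.1 1 ≠ 0 := fun x h0 => by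
    have h1 := congrFun h0 0
    have h2 := congrFun h0 1
    simp at h1 h2
    have : (0 : ℝ) = 1 := by linear_combination hdet - B 1 1 * h1 + B 1 0 * h2
    norm_num at this
  have hrow : ∀ (x : ℝ) n, (B.1 0 - x • B.1 1) ᵥ* (A n).1 =
      (B * A n).1 0 - x • (B * A n).1 1 := fun x n => by
    rw [row_mul, row_mul, sub_vecMul, smul_vecMul]
  set z := fun n => (B * A n) • UpperHalfPlane.I with hz
  -- For a finite limit `x` the squared ratio of the rows `B₀ - x B₁` and `B₁` is `|zₙ - x|²`; for
  -- an infinite limit that of `B₁` and `B₀` is `1 / |zₙ|²`.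
  rcases exists_tendsto_or_of_no_oscillation hosc with ⟨x, hx⟩ | hinf
  · have him : Tendsto (fun n => (z n).im) atTop (𝓝 0) := by
      rw [Metric.tendsto_nhds]
      intro ε hε
      have hb : ∀ᶠ n in atTop, |(z n).re| < |x| + 1 := hx.abs.eventually_lt_const (by linarith)
      filter_upwards [eventually_im_lt hesc (|x| + 1 + C) hε, hb] with n hn hn'
      rw [Real.dist_0_eq_abs, abs_of_pos (z n).im_pos]
      exact hn ((norm_coe_le _).trans (add_le_add hn'.le (hC n)))
    refine exists_tendsto_chordal (hBx x) hB1 (tendsto_norm_div_of_sq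
      (g := fun n => ((z n).re - x) ^ 2 + (z n).im ^ 2) ?_ (Eventually.of_forall fun n => ?_))
    · have := ((hx.sub_const x).pow 2).add (him.pow 2)
      simpa using this
    · rw [hrow, ← row_mul]
      have h1 := row_horodisc (B * A n) x
      have h2 := row_one (B * A n)
      have hp := (z n).im_pos
      refine le_of_eq ?_
      rw [← h1, mul_assoc, mul_comm _ ((B * A n).1 1 0 ^ 2 + _), h2, mul_one]
  · have hB0 : B.1 0 ≠ 0 := by simpa using hBx 0
    refine exists_tendsto_chordal hB1 hB0 (tendsto_norm_div_of_sq
      (g := fun n => (|(z n).re| ^ 2)⁻¹) ?_ ?_)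
    · exact ((tendsto_pow_atTop two_ne_zero).comp hinf).inv_tendsto_atTop
    · filter_upwards [hinf.eventually_gt_atTop 0] with n hn
      have h1 := row_horodisc (B * A n) 0
      have h2 := row_one (B * A n)
      have hp := (z n).im_pos
      rw [← row_mul, ← row_mul, le_inv_mul_iff₀ (by positivity), sq_abs]
      simp only [zero_smul, sub_zero] at h1
      refine le_of_mul_le_mul_right ?_ hp
      change _ ≤ _ * ((B * A n) • UpperHalfPlane.I).im
      rw [h1, mul_assoc]
      change _ * (_ * ((B * A n) • UpperHalfPlane.I).im) ≤ _
      rw [h2]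
      nlinarith [sq_nonneg (z n).im]

/-! ### Oscillation makes all non-contracted rows parallel -/

/-- Suppose that a nonempty open arc of row vectors is contracted arbitrarily, arbitrarily late, by
the partial products of a sequence in `𝓖`. Then any two row vectors that are not contracted to zero
by the semigroup generated by `𝓖` are parallel. -/
theorem det_eq_zero_of_contracted_arc {𝓖 : Set SL(2, ℝ)} {f : ℕ → SL(2, ℝ)} (hf : ∀ i, f i ∈ 𝓖)
    (B : SL(2, ℝ)) {a b : ℝ} (hab : a < b)
    (hcon : ∀ x, a < x → x < b → ∀ δ > 0,
      ∃ᶠ n in atTop, ‖(B.1 0 - x • B.1 1) ᵥ* (partialProd f n).1‖ < δ)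
    {ρ σ : Fin 2 → ℝ}
    (hρ : ∃ ε > 0, ∀ t ∈ Subsemigroup.closure 𝓖, ε ≤ ‖ρ ᵥ* t.1‖)
    (hσ : ∃ ε > 0, ∀ t ∈ Subsemigroup.closure 𝓖, ε ≤ ‖σ ᵥ* t.1‖) :
    ρ 0 * σ 1 - ρ 1 * σ 0 = 0 := by
  set x := (a + b) / 2 with hx
  set d := (b - a) / 2 with hd
  have hdpos : 0 < d := by rw [hd]; linarith
  have crossLe : ∀ v w : Fin 2 → ℝ, |v 0 * w 1 - v 1 * w 0| ≤ 2 * (‖v‖ * ‖w‖) := by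
    intro v w
    have h1 : |v 0 * w 1 - v 1 * w 0| ≤ |v 0| * |w 1| + |v 1| * |w 0| := by
      simpa [abs_mul] using abs_sub (v 0 * w 1) (v 1 * w 0)
    have h2 := mul_le_mul (norm_le_pi_norm v 0) (norm_le_pi_norm w 1)
      (abs_nonneg _) (norm_nonneg _)
    have h3 := mul_le_mul (norm_le_pi_norm v 1) (norm_le_pi_norm w 0)
      (abs_nonneg _) (norm_nonneg _)
    simp only [Real.norm_eq_abs] at h2 h3
    linarith
  -- Write `τ = α u + β v` in the basis of images `u`, `v` of `B₀ - x B₁` and `B₁` under `Fₙ`. If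
  -- `|β / α| < d`, then `τ` is a multiple of the image of a row in the contracted arc, so the later
  -- factors contract it. Hence `d |α| ≤ |β|`, and `|β| ≤ 2 ‖τ‖ ‖u‖`.
  have coord : ∀ τ : Fin 2 → ℝ, (∃ ε > 0, ∀ t ∈ Subsemigroup.closure 𝓖, ε ≤ ‖τ ᵥ* t.1‖) →
      ∀ n, d * |τ 0 * (B * partialProd f n).1 1 1 - τ 1 * (B * partialProd f n).1 1 0| ≤
        2 * (‖τ‖ * ‖(B.1 0 - x • B.1 1) ᵥ* (partialProd f n).1‖) := by
    rintro τ ⟨ε, hε, hτ⟩ n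
    set u := (B.1 0 - x • B.1 1) ᵥ* (partialProd f n).1 with hu
    set v := (B * partialProd f n).1 1 with hv
    have hdet : u 0 * v 1 - u 1 * v 0 = 1 := by
      have h0 : u = (B * partialProd f n).1 0 - x • v := by
        rw [hu, hv, row_mul, row_mul, sub_vecMul, smul_vecMul]
      have := SL2_det (B * partialProd f n)
      rw [h0]
      simp only [Pi.sub_apply, Pi.smul_apply, smul_eq_mul, hv]
      linear_combination this
    set α := τ 0 * v 1 - τ 1 * v 0 with hα
    set β := -(τ 0 * u 1 - τ 1 * u 0) with hβ
    refine le_trans ?_ (crossLe τ u)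
    rw [← abs_neg (τ 0 * u 1 - τ 1 * u 0), ← hβ]
    by_contra! hlt
    have hα0 : α ≠ 0 := by
      rintro h0
      rw [h0, abs_zero, mul_zero] at hlt
      exact hlt.not_ge (abs_nonneg _)
    have hα' : 0 < |α| := abs_pos.mpr hα0
    have hq : |β / α| < d := by rwa [abs_div, div_lt_iff₀ hα']
    obtain ⟨hq1, hq2⟩ := abs_lt.mp hq
    obtain ⟨m, hnm, hm⟩ := frequently_atTop.mp
      (hcon (x - β / α) (by linarith) (by linarith) (ε / |α|) (by positivity)) (n + 1)
    have hmem := inv_mul_partialProd_mem_closure hf (m := n) (n := m) hnm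
    refine (hτ _ hmem).not_gt ?_
    have hτe : τ = α • ((B.1 0 - (x - β / α) • B.1 1) ᵥ* (partialProd f n).1) := by
      have h0 : (B.1 0 - (x - β / α) • B.1 1) ᵥ* (partialProd f n).1 = u + (β / α) • v := by
        rw [hu, hv, row_mul, ← smul_vecMul, ← add_vecMul]
        congr 1
        rw [sub_smul]
        abel
      rw [h0, smul_add, smul_smul, mul_div_cancel₀ _ hα0]
      ext i
      fin_cases i <;> simp [hα, hβ]
      · linear_combination -(τ 0) * hdet
      · linear_combination -(τ 1) * hdet
    rw [hτe, smul_vecMul, vecMul_vecMul, ← Matrix.SpecialLinearGroup.coe_mul,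
      mul_inv_cancel_left, norm_smul, Real.norm_eq_abs]
    rwa [lt_div_iff₀ hα', mul_comm] at hm
  by_contra hne
  have hpos := abs_pos.mpr hne
  set D := |ρ 0 * σ 1 - ρ 1 * σ 0| with hD
  set K := 8 * (‖ρ‖ * ‖σ‖) with hK
  have hK0 : 0 ≤ K := by positivity
  obtain ⟨n, hn⟩ := (hcon x (by linarith) (by linarith) (min 1 (d * D / (K + 1)))
    (by positivity)).exists
  have h1 := coord ρ hρ n
  have h2 := coord σ hσ n
  set u := (B.1 0 - x • B.1 1) ᵥ* (partialProd f n).1 with hu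
  set v := (B * partialProd f n).1 1 with hv
  have hdet : u 0 * v 1 - u 1 * v 0 = 1 := by
    have h0 : u = (B * partialProd f n).1 0 - x • v := by
      rw [hu, hv, row_mul, row_mul, sub_vecMul, smul_vecMul]
    have := SL2_det (B * partialProd f n)
    rw [h0]
    simp only [Pi.sub_apply, Pi.smul_apply, smul_eq_mul, hv]
    linear_combination this
  -- Since `u`, `v` span unit area, the determinant of `ρ` and `σ` is that of their coordinates. All
  -- coordinates are of order `‖u‖`, so it is of order `‖u‖ ^ 2`.
  have e : ρ 0 * σ 1 - ρ 1 * σ 0 = (ρ 0 * v 1 - ρ 1 * v 0) * (-(σ 0 * u 1 - σ 1 * u 0)) -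
      (σ 0 * v 1 - σ 1 * v 0) * (-(ρ 0 * u 1 - ρ 1 * u 0)) := by
    linear_combination (-(ρ 0 * σ 1 - ρ 1 * σ 0)) * hdet
  have hle : d * D ≤ K * ‖u‖ ^ 2 := by
    have h3 := crossLe ρ u
    have h4 := crossLe σ u
    have h5 : D ≤ |ρ 0 * v 1 - ρ 1 * v 0| * |σ 0 * u 1 - σ 1 * u 0| +
        |σ 0 * v 1 - σ 1 * v 0| * |ρ 0 * u 1 - ρ 1 * u 0| := by
      rw [hD, e]
      refine (abs_sub _ _).trans ?_
      rw [abs_mul, abs_mul, abs_neg, abs_neg]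
    have h6 := mul_le_mul h1 h4 (abs_nonneg _) (by positivity)
    have h7 := mul_le_mul h2 h3 (abs_nonneg _) (by positivity)
    have h8 := mul_le_mul_of_nonneg_left h5 hdpos.le
    nlinarith
  have hu1 : ‖u‖ < 1 := hn.trans_le (min_le_left _ _)
  have hu2 : ‖u‖ < d * D / (K + 1) := hn.trans_le (min_le_right _ _)
  rw [lt_div_iff₀ (by linarith)] at hu2
  have hun := norm_nonneg u
  have : ‖u‖ ^ 2 ≤ ‖u‖ := by nlinarith
  nlinarith

/-! ### Semigroups fixing a boundary point -/

/-- The rotation whose bottom row is parallel to a given row vector. -/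
theorem exists_rotation {r : Fin 2 → ℝ} (hr : r ≠ 0) :
    ∃ B : SL(2, ℝ), B • UpperHalfPlane.I = UpperHalfPlane.I ∧ ∃ c : ℝ, 0 < c ∧ B.1 1 = c • r := by
  have hq : 0 < r 0 ^ 2 + r 1 ^ 2 :=
    lt_of_lt_of_le (by have := norm_pos_iff.mpr hr; positivity) (sq_norm_le_sq_add_sq r)
  set s := √(r 0 ^ 2 + r 1 ^ 2) with hs
  have hspos : 0 < s := Real.sqrt_pos.mpr hq
  have hs2 : s ^ 2 = r 0 ^ 2 + r 1 ^ 2 := Real.sq_sqrt hq.le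
  have hdet : (!![r 1 / s, -(r 0 / s); r 0 / s, r 1 / s] : Matrix (Fin 2) (Fin 2) ℝ).det = 1 := by
    rw [Matrix.det_fin_two_of]
    field_simp
    linarith
  have hdet' := hdet
  rw [Matrix.det_fin_two_of] at hdet'
  obtain ⟨B, hB⟩ : ∃ B : SL(2, ℝ), B.1 = !![r 1 / s, -(r 0 / s); r 0 / s, r 1 / s] :=
    ⟨⟨_, hdet⟩, rfl⟩
  have hunit : (r 0 / s) ^ 2 + (r 1 / s) ^ 2 = 1 := by linarith
  refine ⟨B, ?_, s⁻¹, by positivity, ?_⟩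
  · apply UpperHalfPlane.ext
    apply Complex.ext
    · rw [UpperHalfPlane.coe_re, re_smul_I, hB]
      simp
      left
      ring
    · rw [UpperHalfPlane.coe_im, im_smul_I, hB]
      simp [hunit]
  · rw [hB]
    ext i
    fin_cases i <;> simp [div_eq_inv_mul]

/-- The action of `g` on `B g h • I` when `B g B⁻¹` fixes infinity. -/
theorem re_im_of_parallel {B g : SL(2, ℝ)} (hB : B • UpperHalfPlane.I = UpperHalfPlane.I)
    (hpar : B.1 1 0 * (B * g).1 1 1 - B.1 1 1 * (B * g).1 1 0 = 0) (h : SL(2, ℝ)) :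
    ((B * (g * h)) • UpperHalfPlane.I).re = ((B * g) • UpperHalfPlane.I).re +
        ((B * g) • UpperHalfPlane.I).im * ((B * h) • UpperHalfPlane.I).re ∧
      ((B * (g * h)) • UpperHalfPlane.I).im =
        ((B * g) • UpperHalfPlane.I).im * ((B * h) • UpperHalfPlane.I).im := by
  have hc : (B * g * B⁻¹) 1 0 = 0 := by
    rw [Matrix.SpecialLinearGroup.coe_mul, Matrix.SpecialLinearGroup.SL2_inv_expl,
      Matrix.mul_apply, Fin.sum_univ_two]
    rw [Matrix.SpecialLinearGroup.coe_mul] at hpar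
    simp
    linarith
  obtain ⟨u, v, huv⟩ := UpperHalfPlane.exists_SL2_smul_eq_of_apply_zero_one_eq_zero _ hc
  have h1 : (B * g) • UpperHalfPlane.I = v +ᵥ u • UpperHalfPlane.I := by
    have := congrFun huv UpperHalfPlane.I
    simp only [Function.comp_apply] at this
    rw [← this]
    conv_rhs => rw [← hB]
    rw [smul_smul, inv_mul_cancel_right]
  have h2 : (B * (g * h)) • UpperHalfPlane.I = v +ᵥ u • ((B * h) • UpperHalfPlane.I) := by
    have := congrFun huv ((B * h) • UpperHalfPlane.I)
    simp only [Function.comp_apply] at this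
    rw [← this, smul_smul]
    congr 1
    group
  rw [h1, h2]
  simp

theorem dist_mul_smul_I {B : SL(2, ℝ)} (hB : B • UpperHalfPlane.I = UpperHalfPlane.I)
    (g : SL(2, ℝ)) : dist ((B * g) • UpperHalfPlane.I) UpperHalfPlane.I =
      dist (g • UpperHalfPlane.I) UpperHalfPlane.I := by
  conv_lhs => rw [← hB, mul_smul, dist_smul, hB]

/-- Translations in opposite directions generate bounded sequences of partial products. -/
theorem Escapes.false_of_opposite_translations {𝓖 : Set SL(2, ℝ)} (h : Escapes 𝓖) {B : SL(2, ℝ)}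
    (hB : B • UpperHalfPlane.I = UpperHalfPlane.I)
    (hpar : ∀ t ∈ Subsemigroup.closure 𝓖,
      B.1 1 0 * (B * t).1 1 1 - B.1 1 1 * (B * t).1 1 0 = 0)
    {f g : SL(2, ℝ)} (hf : f ∈ 𝓖) (hg : g ∈ 𝓖)
    (hf1 : ((B * f) • UpperHalfPlane.I).im = 1) (hg1 : ((B * g) • UpperHalfPlane.I).im = 1)
    (hf0 : 0 ≤ ((B * f) • UpperHalfPlane.I).re) (hg0 : ((B * g) • UpperHalfPlane.I).re ≤ 0) :
    False := by
  classical
  -- Move right from a nonpositive real part and left from a positive one; the real part never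
  -- leaves `[b, a]`.
  let τ : SL(2, ℝ) → SL(2, ℝ) := fun u => if ((B * u) • UpperHalfPlane.I).re ≤ 0 then f else g
  have hτ : ∀ u, τ u ∈ Subsemigroup.closure 𝓖 := fun u => by
    simp only [τ]
    split_ifs
    exacts [Subsemigroup.subset_closure hf, Subsemigroup.subset_closure hg]
  let G : ℕ → SL(2, ℝ) := fun k => Nat.rec 1 (fun _ u => u * τ u) k
  have Gs : ∀ k, G (k + 1) = G k * τ (G k) := fun k => rfl
  have hG : ∀ k, partialProd (fun k => τ (G k)) k = G k := by
    intro k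
    induction k with
    | zero => rfl
    | succ k ih => rw [partialProd, ih]
  have hGpar : ∀ k, B.1 1 0 * (B * G k).1 1 1 - B.1 1 1 * (B * G k).1 1 0 = 0 := by
    have hmem : ∀ k, G (k + 1) ∈ Subsemigroup.closure 𝓖 := by
      intro k
      induction k with
      | zero => simpa [G] using hτ 1
      | succ k ih => exact mul_mem ih (hτ _)
    rintro (_ | k)
    · simp [G]
      ring
    · exact hpar _ (hmem k)
  set a := ((B * f) • UpperHalfPlane.I).re with ha
  set b := ((B * g) • UpperHalfPlane.I).re with hb
  have hbd : ∀ k, ((B * G k) • UpperHalfPlane.I).im = 1 ∧ b ≤ ((B * G k) • UpperHalfPlane.I).re ∧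
      ((B * G k) • UpperHalfPlane.I).re ≤ a := by
    intro k
    induction k with
    | zero => simp [G, hB, hf0, hg0]
    | succ k ih =>
      obtain ⟨h1, h2⟩ := re_im_of_parallel hB (hGpar k) (τ (G k))
      obtain ⟨ih1, ih2, ih3⟩ := ih
      rw [Gs, h1, h2, ih1]
      by_cases hk : ((B * G k) • UpperHalfPlane.I).re ≤ 0
      · have : τ (G k) = f := if_pos hk
        rw [this, hf1, ← ha]
        refine ⟨by norm_num, ?_, ?_⟩ <;> linarith
      · have : τ (G k) = g := if_neg hk
        rw [this, hg1, ← hb]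
        refine ⟨by norm_num, ?_, ?_⟩ <;> linarith
  refine h.not_bounded (t := fun k => τ (G k)) (fun k => hτ _)
    (2 * (1 + ((a - b + 1) + 1) ^ 2 / (2 * 1))) fun k => ?_
  obtain ⟨h1, h2, h3⟩ := hbd k
  rw [hG, ← dist_mul_smul_I hB]
  refine dist_I_le one_pos ((norm_coe_le _).trans ?_) h1.ge
  rw [h1]
  have : |((B * G k) • UpperHalfPlane.I).re| ≤ a - b := abs_le.mpr ⟨by linarith, by linarith⟩
  linarith

/-- In the case of semigroups fixing a boundary point, the real parts do not oscillate. -/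
theorem Escapes.not_oscillating_of_parallel {𝓖 : Set SL(2, ℝ)} (h𝓖 : 𝓖.Finite) (h : Escapes 𝓖)
    {B : SL(2, ℝ)} (hB : B • UpperHalfPlane.I = UpperHalfPlane.I)
    (hpar : ∀ t ∈ Subsemigroup.closure 𝓖,
      B.1 1 0 * (B * t).1 1 1 - B.1 1 1 * (B * t).1 1 0 = 0)
    {C : ℝ} (hC : ∀ t ∈ Subsemigroup.closure 𝓖, ((B * t) • UpperHalfPlane.I).im ≤ C)
    {f : ℕ → SL(2, ℝ)} (hf : ∀ i, f i ∈ 𝓖) {a b : ℝ} (hab : a < b) :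
    ¬ ((∃ᶠ n in atTop, ((B * partialProd f n) • UpperHalfPlane.I).re < a) ∧
      ∃ᶠ n in atTop, b < ((B * partialProd f n) • UpperHalfPlane.I).re) := by
  set y : SL(2, ℝ) → ℝ := fun g => ((B * g) • UpperHalfPlane.I).im with hy
  set x : SL(2, ℝ) → ℝ := fun g => ((B * g) • UpperHalfPlane.I).re with hx
  have ypos : ∀ g, 0 < y g := fun g => ((B * g) • UpperHalfPlane.I).im_pos
  -- A generator with `y g > 1` would have powers of unbounded height.
  have yle : ∀ g ∈ 𝓖, y g ≤ 1 := by
    intro g hg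
    have hmem : ∀ n : ℕ, g ^ (n + 1) ∈ Subsemigroup.closure 𝓖 := by
      intro n
      induction n with
      | zero => simpa using Subsemigroup.subset_closure hg
      | succ n ih =>
        rw [pow_succ]
        exact mul_mem ih (Subsemigroup.subset_closure hg)
    have hpow : ∀ n : ℕ, y (g ^ (n + 1)) = y g ^ (n + 1) := by
      intro n
      induction n with
      | zero => simp
      | succ n ih =>
        rw [pow_succ g, pow_succ (y g), ← ih]
        exact (re_im_of_parallel hB (hpar _ (hmem n)) g).2
    by_contra! hgt
    obtain ⟨n, hn⟩ := ((tendsto_pow_atTop_atTop_of_one_lt hgt).eventually_gt_atTop C).exists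
    have h1 : y g ^ n ≤ y g ^ (n + 1) := pow_le_pow_right₀ hgt.le (Nat.le_succ n)
    have h2 := hC _ (hmem n)
    have h3 := hpow n
    simp only [hy] at *
    linarith
  have hstep : ∀ n, x (partialProd f (n + 1)) =
      x (partialProd f n) + y (partialProd f n) * x (f n) ∧
      y (partialProd f (n + 1)) = y (partialProd f n) * y (f n) := by
    intro n
    refine re_im_of_parallel hB ?_ (f n)
    rcases n with _ | n
    · simp [partialProd]
      ring
    · exact hpar _ (partialProd_succ_mem_closure hf n)
  have hanti : Antitone fun n => y (partialProd f n) := by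
    refine antitone_nat_of_succ_le fun n => ?_
    rw [(hstep n).2]
    exact mul_le_of_le_one_right (ypos _).le (yle _ (hf n))
  -- Finiteness bounds each horizontal shift by a multiple of the loss `1 - y g`. For translations
  -- the quotient is `0` by convention, which is harmless.
  obtain ⟨K, hK⟩ := (h𝓖.image fun g => |x g| / (1 - y g)).bddAbove
  have hKle : ∀ g ∈ 𝓖, y g ≠ 1 → |x g| ≤ max K 0 * (1 - y g) := by
    intro g hg hne
    have h1 : 0 < 1 - y g := by
      have := lt_of_le_of_ne (yle g hg) hne
      linarith
    rw [← div_le_iff₀ h1]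
    exact (hK (Set.mem_image_of_mem _ hg)).trans (le_max_left _ _)
  have hK0 : 0 ≤ max K 0 := le_max_right _ _
  -- All translations among the generators shift weakly in one direction, and this decides whether
  -- `x` or `-x` is corrected to a monotone sequence.
  by_cases hneg : ∃ g ∈ 𝓖, y g = 1 ∧ x g ≤ 0
  · obtain ⟨g, hg, hg1, hg0⟩ := hneg
    have hcase : ∀ k ∈ 𝓖, y k = 1 → x k ≤ 0 := fun k hk hk1 => by
      by_contra! hk0
      exact h.false_of_opposite_translations hB hpar hk hg hk1 hg1 hk0.le hg0
    have hmono : Monotone fun n => -x (partialProd f n) - max K 0 * y (partialProd f n) := by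
      refine monotone_nat_of_le_succ fun n => ?_
      rw [(hstep n).1, (hstep n).2]
      have hp := ypos (partialProd f n)
      have : 0 ≤ -x (f n) + max K 0 * (1 - y (f n)) := by
        by_cases h1 : y (f n) = 1
        · rw [h1]
          linarith [hcase _ (hf n) h1]
        · linarith [hKle _ (hf n) h1, le_abs_self (x (f n))]
      nlinarith [mul_nonneg hp.le this]
    have := not_oscillating_of_monotone hK0 hanti (fun n => (ypos _).le) hmono
      (neg_lt_neg hab)
    rintro ⟨h1, h2⟩
    exact this ⟨h2.mono fun n hn => neg_lt_neg hn, h1.mono fun n hn => neg_lt_neg hn⟩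
  · push Not at hneg
    have hmono : Monotone fun n => x (partialProd f n) - max K 0 * y (partialProd f n) := by
      refine monotone_nat_of_le_succ fun n => ?_
      rw [(hstep n).1, (hstep n).2]
      have hp := ypos (partialProd f n)
      have : 0 ≤ x (f n) + max K 0 * (1 - y (f n)) := by
        by_cases h1 : y (f n) = 1
        · rw [h1]
          linarith [hneg _ (hf n) h1]
        · linarith [hKle _ (hf n) h1, neg_abs_le (x (f n))]
      nlinarith [mul_nonneg hp.le this]
    exact not_oscillating_of_monotone hK0 hanti (fun n => (ypos _).le) hmono hab

/-! ### Escape implies ideal convergence -/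

/-- If all sequences of partial products of elements of a finite set escape, then they converge
pointwise to points of the extended real line. -/
theorem Escapes.exists_tendsto {𝓖 : Set SL(2, ℝ)} (h𝓖 : 𝓖.Finite) (h : Escapes 𝓖)
    {f : ℕ → SL(2, ℝ)} (hf : ∀ i, f i ∈ 𝓖) :
    ∃ p ∈ extendedReals, ∀ w : ℍ,
      Tendsto (fun n => chordal (toMob (partialProd f n) (ofH w)) p) atTop (𝓝 0) := by
  obtain ⟨r, hr, ε, hε, hrε⟩ := h.exists_row
  obtain ⟨B, hB, c, hc, hBr⟩ := exists_rotation hr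
  have hrow : ∀ t ∈ Subsemigroup.closure 𝓖, c * ε ≤ ‖B.1 1 ᵥ* t.1‖ := by
    intro t ht
    rw [hBr, smul_vecMul, norm_smul, Real.norm_of_nonneg hc.le]
    exact mul_le_mul_of_nonneg_left (hrε t ht) hc.le
  have hcε : 0 < c * ε := by positivity
  have hC : ∀ t ∈ Subsemigroup.closure 𝓖,
      ((B * t) • UpperHalfPlane.I).im ≤ 1 / (c * ε) ^ 2 := by
    intro t ht
    have h1 := hrow t ht
    have h2 := row_one (B * t)
    have h3 := sq_norm_le_sq_add_sq ((B * t).1 1)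
    rw [row_mul] at h2 h3
    rw [le_div_iff₀ (by positivity), ← h2, mul_comm]
    gcongr
    exact (pow_le_pow_left₀ hcε.le h1 2).trans h3
  have hesc : Tendsto (fun n => dist ((B * partialProd f n) • UpperHalfPlane.I) UpperHalfPlane.I)
      atTop atTop := by
    simp only [dist_mul_smul_I hB]
    exact h f hf
  have hC' : ∀ n, ((B * partialProd f n) • UpperHalfPlane.I).im ≤ max 1 (1 / (c * ε) ^ 2) := by
    rintro (_ | n)
    · simp [partialProd, hB]
    · exact (hC _ (partialProd_succ_mem_closure hf n)).trans (le_max_right _ _)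
  refine exists_tendsto_chordal_of_no_oscillation hesc hC' fun a b hab hosc => ?_
  obtain ⟨D, hD⟩ := (h𝓖.image fun g => dist (g • UpperHalfPlane.I) UpperHalfPlane.I).bddAbove
  have hstep : ∀ n, dist (((B * partialProd f (n + 1)) • UpperHalfPlane.I : ℍ) : ℂ)
      (((B * partialProd f n) • UpperHalfPlane.I : ℍ) : ℂ) ≤
        (Real.exp D - 1) * ((B * partialProd f n) • UpperHalfPlane.I).im := by
    intro n
    have h1 := UpperHalfPlane.dist_coe_le ((B * partialProd f (n + 1)) • UpperHalfPlane.I)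
      ((B * partialProd f n) • UpperHalfPlane.I)
    have h2 : dist ((B * partialProd f (n + 1)) • UpperHalfPlane.I)
        ((B * partialProd f n) • UpperHalfPlane.I) ≤ D := by
      rw [partialProd, ← mul_assoc, mul_smul, dist_smul]
      exact hD (Set.mem_image_of_mem _ (hf n))
    refine h1.trans ?_
    rw [mul_comm]
    gcongr
  have hcon : ∀ x, a < x → x < b → ∀ δ > 0,
      ∃ᶠ n in atTop, ‖(B.1 0 - x • B.1 1) ᵥ* (partialProd f n).1‖ < δ := by
    intro x hax hxb δ hδ
    refine (frequently_mem_horodisc hesc hC' hstep (hosc.1.mono fun n hn => hn.trans hax)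
      (hosc.2.mono fun n hn => hxb.trans hn) (δ := δ ^ 2) (by positivity)).mono fun n hn => ?_
    rw [← row_horodisc] at hn
    have h1 := lt_of_mul_lt_mul_right hn ((B * partialProd f n) • UpperHalfPlane.I).im_pos.le
    have h2 := sq_norm_le_sq_add_sq ((B * partialProd f n).1 0 - x • (B * partialProd f n).1 1)
    rw [sub_vecMul, smul_vecMul, ← row_mul, ← row_mul]
    exact lt_of_pow_lt_pow_left₀ 2 hδ.le (h2.trans_lt h1)
  have hpar : ∀ t ∈ Subsemigroup.closure 𝓖,
      B.1 1 0 * (B * t).1 1 1 - B.1 1 1 * (B * t).1 1 0 = 0 := by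
    intro t ht
    -- If the row `B₁` is not contracted, neither is `B₁ t` for `t` in the semigroup, so the two are
    -- parallel.
    refine det_eq_zero_of_contracted_arc hf B hab hcon ⟨c * ε, hcε, hrow⟩
      ⟨c * ε, hcε, fun s hs => ?_⟩
    rw [row_mul, vecMul_vecMul, ← Matrix.SpecialLinearGroup.coe_mul]
    exact hrow _ (mul_mem ht hs)
  exact h.not_oscillating_of_parallel h𝓖 hB hpar hC hf hab hosc

/-! ### Composition sequences -/

theorem isCompositionSeq_iff {𝓖 : Set SL(2, ℝ)} {F : ℕ → Mob} :
    IsCompositionSeq (toMob '' 𝓖) F ↔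
      ∃ f : ℕ → SL(2, ℝ), (∀ i, f i ∈ 𝓖) ∧ F = fun n => toMob (partialProd f n) := by
  constructor
  · rintro ⟨f, hf, h0, hs⟩
    choose g hg hgf using hf
    refine ⟨g, hg, funext fun n => ?_⟩
    induction n with
    | zero => rw [h0, partialProd, map_one]
    | succ n ih => rw [hs, partialProd, map_mul, ih, hgf]
  · rintro ⟨f, hf, rfl⟩
    exact ⟨fun i => toMob (f i), fun i => ⟨f i, hf i, rfl⟩, map_one toMob,
      fun n => map_mul toMob _ _⟩

theorem forall_isEscaping_iff {𝓖 : Set SL(2, ℝ)} :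
    (∀ F, IsCompositionSeq (toMob '' 𝓖) F → IsEscaping F) ↔ Escapes 𝓖 := by
  constructor
  · intro h f hf
    exact (isEscaping_toMob_iff _).mp (h _ (isCompositionSeq_iff.mpr ⟨f, hf, rfl⟩))
  · intro h F hF
    obtain ⟨f, hf, rfl⟩ := isCompositionSeq_iff.mp hF
    exact (isEscaping_toMob_iff _).mpr (h f hf)

theorem mem_closure_image_toMob {𝓖 : Set SL(2, ℝ)} {g : Mob} :
    g ∈ Subsemigroup.closure (toMob '' 𝓖) ↔ ∃ t ∈ Subsemigroup.closure 𝓖, toMob t = g := by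
  have := MulHom.map_mclosure (toMob : SL(2, ℝ) →ₙ* Mob) 𝓖
  rw [show toMob '' 𝓖 = (toMob : SL(2, ℝ) →ₙ* Mob) '' 𝓖 from rfl, ← this, Subsemigroup.mem_map]
  rfl

/-- Semidiscrete inverse-free semigroups are those whose closure omits the identity. -/
theorem isSemidiscrete_and_isInverseFree_iff (S : Subsemigroup Mob) :
    IsSemidiscrete S ∧ IsInverseFree S ↔ (1 : Mob) ∉ closure (S : Set Mob) := by
  constructor
  · rintro ⟨h1, h2⟩ h
    -- The identity is its own inverse.
    have h3 : (1 : Mob) ∉ S := fun h3 => h2 1 h3 (by rwa [inv_one])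
    refine h1 ?_
    rw [accPt_principal_iff_clusterPt, Set.sdiff_singleton_eq_self h3]
    exact mem_closure_iff_clusterPt.mp h
  · intro h
    refine ⟨fun hacc => h ?_, fun g hg hg' => h (subset_closure ?_)⟩
    · exact mem_closure_iff_clusterPt.mpr hacc.clusterPt
    · have := mul_mem hg hg'
      rwa [mul_inv_cancel] at this

/-- One direction needs only continuity of `toMob` at the identity, the other only evaluation at
`I`, so the sign ambiguity of the lift plays no role. -/
theorem one_notMem_closure_iff {𝓖 : Set SL(2, ℝ)} :
    (1 : Mob) ∉ closure (Subsemigroup.closure (toMob '' 𝓖) : Set Mob) ↔ Escapes 𝓖 := by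
  constructor
  · intro h
    obtain ⟨ε, hε, hd⟩ : ∃ ε > 0, ∀ g ∈ Subsemigroup.closure (toMob '' 𝓖), ε ≤ dist g 1 := by
      rw [Metric.mem_closure_iff] at h
      push Not at h
      obtain ⟨ε, hε, h⟩ := h
      exact ⟨ε, hε, fun g hg => by rw [dist_comm]; exact h g hg⟩
    refine escapes_of_nhds_one ?_
    filter_upwards [tendsto_dist_toMob_one.eventually_lt_const hε] with A hA hmem
    exact hA.not_ge (hd _ (mem_closure_image_toMob.mpr ⟨A, hmem, rfl⟩))
  · intro h hcl
    obtain ⟨ε, hε, hd⟩ := h.exists_le_dist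
    obtain ⟨δ, hδ, hlt⟩ := dist_I_lt_of_chordal_lt hε
    obtain ⟨g, hg, hgd⟩ := Metric.mem_closure_iff.mp hcl δ hδ
    obtain ⟨t, ht, rfl⟩ := mem_closure_image_toMob.mp hg
    refine (hlt (t • UpperHalfPlane.I) ?_).not_ge (hd t ht)
    rw [dist_comm] at hgd
    refine lt_of_le_of_lt ?_ hgd
    rw [← toMob_ofH]
    exact le_ciSup (Mob.bddAbove_chordal (toMob t) 1) (ofH UpperHalfPlane.I)

end RealMobius

open RealMobius in
theorem theorem1p1 (𝓕 : Set Mob) (h𝓕 : 𝓕.Finite) (S : Subsemigroup Mob)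
    (hS : S = Subsemigroup.closure 𝓕) :
    List.TFAE [
      ∀ F : ℕ → Mob, IsCompositionSeq 𝓕 F → IsEscaping F,
      ∀ F : ℕ → Mob, IsCompositionSeq 𝓕 F → ConvergesIdeally F,
      IsSemidiscrete S ∧ IsInverseFree S] := by
  subst hS
  obtain ⟨𝓖, hfin, rfl⟩ : ∃ 𝓖 : Set SL(2, ℝ), 𝓖.Finite ∧ toMob '' 𝓖 = 𝓕 :=
    ⟨Function.surjInv toMob_surjective '' 𝓕, h𝓕.image _, by
      simp [Set.image_image, Function.surjInv_eq]⟩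
  tfae_have 1 ↔ 3 := by
    rw [isSemidiscrete_and_isInverseFree_iff, one_notMem_closure_iff, forall_isEscaping_iff]
  tfae_have 2 → 1 := fun h F hF => (h F hF).1
  tfae_have 1 → 2 := by
    intro h F hF
    refine ⟨h F hF, ?_⟩
    obtain ⟨f, hf, rfl⟩ := isCompositionSeq_iff.mp hF
    exact (forall_isEscaping_iff.mp h).exists_tendsto hfin hf
  tfae_finish
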